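/- Let $(M^n,g)$ be a closed (compact, without boundary) smooth Riemannian manifold with volume measure $\nu$, let $f\in C^2(M)$, $d\mu=e^{-f}d\nu$, and let $T$ be a smooth $(1,1)$-tensor field on $M$ that is symmetric and positive definite with respect to $g$. Put $T(X,Y)=\langle T(X),Y\rangle$ and $$\mathcal L w=\operatorname{div}(T(\nabla w))-\langle\nabla f,T(\nabla w)\rangle .$$ For $u:M\to\mathbb R^N$ the operator $\mathcal L$ acts on each component, and $T(\nabla u,\nabla u)=\sum_k T(\nabla u_k,\nabla u_k)$. Let $a<b$, let $u:M\times[a,b]\to\mathbb R^N$ be smooth, and let $\psi:[a,b]\to\mathbb R$ be bounded above with $\psi^2$ integrable. Suppose that on $M\times[a,b]$ $$|u_t-\mathcal L u|\le\psi(t)\left(|u|+\sqrt{T(\nabla u,\nabla u)}\right).$$ Put $$I(t)=\int_M|u(\cdot,t)|^2\,d\mu,\qquad D(t)=-\int_M T(\nabla u,\nabla u)\,d\mu,\qquad U(t)=\frac{D(t)}{I(t)}$$ (with $U(t)=0$ if $I(t)=0$). Then $$I(b)\ \ge\ I(a)\exp\left\{(b-a)\left(\Big(2+\sup_{[a,b]}\psi\Big)\exp\Big(\int_a^b\psi^2(t)\,dt\Big)\,(U(a)-1)+2-2\sup_{[a,b]}\psi\right)\right\}.$$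 In particular, if $u(\cdot,b)=0$ on $M$, then $u=0$ on $M\times[a,b]$ (backward uniqueness). -/

import Mathlib

open Set MeasureTheory Bundle
open scoped Manifold ContDiff

/-!
Geometry of a Riemannian manifold `(M, g)` without boundary, modelled on `ℝⁿ`, and the
weighted operator `𝓛 u = div_f (T ∇u)`.
-/

namespace ParabolicFrequency

noncomputable section

/-- A smooth Riemannian metric on an `n`-dimensional manifold `M`. -/
abbrev SmoothMetric (n : ℕ) (M : Type*) [TopologicalSpace M]
    [ChartedSpace (EuclideanSpace ℝ (Fin n)) M] [IsManifold (𝓡 n) ∞ M] :=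
  ContMDiffRiemannianMetric (𝓡 n) ∞ (EuclideanSpace ℝ (Fin n))
    (fun x : M => TangentSpace (𝓡 n) x)

variable {n : ℕ} {M : Type*} [TopologicalSpace M] [ChartedSpace (EuclideanSpace ℝ (Fin n)) M]
  [IsManifold (𝓡 n) ∞ M]

/-- The coordinate vector `∂_i` of the chart centred at `y`, at the point with coordinates `z`. -/
def coordVec (y : M) (z : EuclideanSpace ℝ (Fin n)) (i : Fin n) :
    TangentSpace (𝓡 n) ((extChartAt (𝓡 n) y).symm z) :=
  mfderiv (𝓡 n) (𝓡 n) (extChartAt (𝓡 n) y).symm z (EuclideanSpace.single i (1 : ℝ))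

/-- The matrix `g_ij = g(∂_i, ∂_j)` in the chart centred at `y`, at the coordinates `z`. -/
def gramMatrix (g : SmoothMetric n M) (y : M) (z : EuclideanSpace ℝ (Fin n)) :
    Matrix (Fin n) (Fin n) ℝ :=
  Matrix.of fun i j =>
    g.inner ((extChartAt (𝓡 n) y).symm z) (coordVec y z i) (coordVec y z j)

/-- The Riemannian volume density `√(det g_ij)` in the chart centred at `y`. -/
def volDensity (g : SmoothMetric n M) (y : M) (z : EuclideanSpace ℝ (Fin n)) : ℝ :=
  Real.sqrt (gramMatrix g y z).det

/-- The Riemannian volume of the domain of the chart centred at `y`, extended by zero to `M`: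
the image of `√(det g_ij) dz` under the inverse chart. -/
def chartVolume [MeasurableSpace M] (g : SmoothMetric n M) (y : M) : Measure M :=
  Measure.map (extChartAt (𝓡 n) y).symm
    ((volume.restrict (extChartAt (𝓡 n) y).target).withDensity
      fun z => ENNReal.ofReal (volDensity g y z))

/-- The Riemannian volume measure `ν` of `(M, g)`: the least measure that dominates the volume of
every chart domain. The chart volumes agree on overlaps of the chart domains, so on each chart
domain `ν` is the volume of that chart. -/
def riemannianVolume [MeasurableSpace M] (g : SmoothMetric n M) : Measure M :=
  ⨆ y : M, chartVolume g y

/-- The weighted measure `dμ = e^{-f} dν`. -/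
def weightedVolume [MeasurableSpace M] (g : SmoothMetric n M) (f : M → ℝ) : Measure M :=
  (riemannianVolume g).withDensity fun x => ENNReal.ofReal (Real.exp (-f x))

/-- The gradient `∇w` of a real function: the vector that `g` identifies with the differential of
`w` (the map `v ↦ g(v, ·)` is invertible, so `inverse` is its inverse). -/
def grad (g : SmoothMetric n M) (w : M → ℝ) (x : M) : TangentSpace (𝓡 n) x :=
  (g.inner x).inverse (mfderiv (𝓡 n) 𝓘(ℝ) w x)

/-- The divergence of a vector field, `(1 / √det g) ∑ i, ∂_i (√det g X^i)`, computed at `x` in the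
chart centred at `x` (the value does not depend on the chart). -/
def divergence (g : SmoothMetric n M) (X : (x : M) → TangentSpace (𝓡 n) x) (x : M) : ℝ :=
  (volDensity g x (extChartAt (𝓡 n) x x))⁻¹ *
    ∑ i : Fin n,
      fderiv ℝ
        (fun z : EuclideanSpace ℝ (Fin n) =>
          volDensity g x z *
            (show EuclideanSpace ℝ (Fin n) from
              mfderiv (𝓡 n) (𝓡 n) (extChartAt (𝓡 n) x) ((extChartAt (𝓡 n) x).symm z)
                (X ((extChartAt (𝓡 n) x).symm z))) i)
        (extChartAt (𝓡 n) x x) (EuclideanSpace.single i (1 : ℝ))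

/-- A smooth `(1,1)`-tensor field that is symmetric and positive definite with respect to `g`. -/
structure IsSymmPosTensor (g : SmoothMetric n M)
    (T : (x : M) → TangentSpace (𝓡 n) x →L[ℝ] TangentSpace (𝓡 n) x) : Prop where
  contMDiff : ContMDiff (𝓡 n)
    ((𝓡 n).prod 𝓘(ℝ, EuclideanSpace ℝ (Fin n) →L[ℝ] EuclideanSpace ℝ (Fin n))) ∞
    (fun x => TotalSpace.mk' (EuclideanSpace ℝ (Fin n) →L[ℝ] EuclideanSpace ℝ (Fin n))
      (E := fun x : M => TangentSpace (𝓡 n) x →L[ℝ] TangentSpace (𝓡 n) x) x (T x))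
  symm : ∀ (x : M) (v w : TangentSpace (𝓡 n) x), g.inner x (T x v) w = g.inner x v (T x w)
  pos : ∀ (x : M) (v : TangentSpace (𝓡 n) x), v ≠ 0 → 0 < g.inner x (T x v) v

/-- `𝓛 w = div (T ∇w) - ⟨∇f, T ∇w⟩` for a real function `w`. -/
def diffusion (g : SmoothMetric n M) (f : M → ℝ)
    (T : (x : M) → TangentSpace (𝓡 n) x →L[ℝ] TangentSpace (𝓡 n) x) (w : M → ℝ) (x : M) : ℝ :=
  divergence g (fun y => T y (grad g w y)) x - g.inner x (grad g f x) (T x (grad g w x))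

variable {N : ℕ}

/-- `𝓛 w` for `w : M → ℝᴺ`, component by component. -/
def vecDiffusion (g : SmoothMetric n M) (f : M → ℝ)
    (T : (x : M) → TangentSpace (𝓡 n) x →L[ℝ] TangentSpace (𝓡 n) x)
    (w : M → EuclideanSpace ℝ (Fin N)) (x : M) : EuclideanSpace ℝ (Fin N) :=
  WithLp.toLp 2 fun k => diffusion g f T (fun y => w y k) x

/-- `T(∇w, ∇w) = ∑ k, ⟨T ∇w_k, ∇w_k⟩` for `w : M → ℝᴺ`. -/
def gradEnergy (g : SmoothMetric n M)
    (T : (x : M) → TangentSpace (𝓡 n) x →L[ℝ] TangentSpace (𝓡 n) x)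
    (w : M → EuclideanSpace ℝ (Fin N)) (x : M) : ℝ :=
  ∑ k : Fin N,
    g.inner x (T x (grad g (fun y => w y k) x)) (grad g (fun y => w y k) x)

/-- `I(t) = ∫ |u(·,t)|² dμ`. -/
def freqI [MeasurableSpace M] (g : SmoothMetric n M) (f : M → ℝ)
    (u : M → ℝ → EuclideanSpace ℝ (Fin N)) (t : ℝ) : ℝ :=
  ∫ x, ‖u x t‖ ^ 2 ∂(weightedVolume g f)

/-- `D(t) = - ∫ T(∇u, ∇u) dμ`. -/
def freqD [MeasurableSpace M] (g : SmoothMetric n M) (f : M → ℝ)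
    (T : (x : M) → TangentSpace (𝓡 n) x →L[ℝ] TangentSpace (𝓡 n) x)
    (u : M → ℝ → EuclideanSpace ℝ (Fin N)) (t : ℝ) : ℝ :=
  -∫ x, gradEnergy g T (fun y => u y t) x ∂(weightedVolume g f)

/-- The parabolic frequency `U(t) = D(t) / I(t)`. -/
def freqU [MeasurableSpace M] (g : SmoothMetric n M) (f : M → ℝ)
    (T : (x : M) → TangentSpace (𝓡 n) x →L[ℝ] TangentSpace (𝓡 n) x)
    (u : M → ℝ → EuclideanSpace ℝ (Fin N)) (t : ℝ) : ℝ :=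
  freqD g f T u t / freqI g f u t

end

end ParabolicFrequency

set_option linter.unusedSectionVars false

/-! Write `h = u_t - 𝓛u`. The divergence theorem, tested with `e^{-f} v`, makes `𝓛` symmetric in
`L²(μ)` with `∫⟨u, 𝓛u⟩ = D`. Hence `I' = 2∫⟨u_t, u⟩` and `D' = 2∫⟨u_t, 𝓛u⟩`.

Young's inequality and the bound on `h` give `I' ≥ (2 + ψ)D - 3ψI` (`mass_derivative_bound`).
Cauchy-Schwarz for `u` and `𝓛u + h/2`, which splits `u_t` evenly between its two roles, gives `D'I -
DI' ≥ -(I/2)∫|h|² ≥ -ψ² I (I - D)` (`frequency_derivative_bound`), that is, `U' ≥ -ψ²(1 - U)`.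

So `log(1 - U)` grows at most at rate `ψ²`, and `1 - U(t) ≤ exp(∫ψ²)(1 - U(a))`. Inserting this in
`I'/I ≥ (2 + ψ)U - 3ψ = 2 - 2ψ - (2 + ψ)(1 - U)` bounds `(log I)'` below by a constant; integration
is the claim. All this needs `I > 0`, but the resulting bound is uniform, so `I` cannot reach zero
once it is positive (`growth`). Started at any `t` with `I(t) > 0`, the bound forces `I(b) > 0`,
which is backward uniqueness.

The geometric input is the divergence theorem for the concrete volume and divergence
(`integral_mul_divergence`). Its version for test functions supported in one chart comes first;
since one side of that identity is free of charts, it also yields the chart independence of the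
divergence. Time derivatives of `I` and `D` come from a single difference quotient lemma
(`hasDerivWithinAt_of_pairing`). -/

namespace ParabolicFrequency

noncomputable section

/-! ### Chart representations of metric, tensor and vector fields -/

section ChartCalculus

variable {n : ℕ} {M : Type*} [TopologicalSpace M] [ChartedSpace (EuclideanSpace ℝ (Fin n)) M]

/-- The derivative of the inverse chart centred at `y`, at the coordinates `z`. -/
def chartFrame (y : M) (z : EuclideanSpace ℝ (Fin n)) :
    EuclideanSpace ℝ (Fin n) →L[ℝ] TangentSpace (𝓡 n) ((extChartAt (𝓡 n) y).symm z) :=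
  mfderiv (𝓡 n) (𝓡 n) (extChartAt (𝓡 n) y).symm z

/-- The derivative of the chart centred at `y`, at the point `x`. -/
def chartDiff (y x : M) : TangentSpace (𝓡 n) x →L[ℝ] EuclideanSpace ℝ (Fin n) :=
  mfderiv (𝓡 n) (𝓡 n) (extChartAt (𝓡 n) y) x

variable [IsManifold (𝓡 n) ∞ M]

instance : IsManifold (𝓡 n) 1 M := IsManifold.of_le (n := ∞) (by simp)

theorem mdifferentiableAt_extChartAt_symm {y : M} {z : EuclideanSpace ℝ (Fin n)}
    (hz : z ∈ (extChartAt (𝓡 n) y).target) :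
    MDifferentiableAt (𝓡 n) (𝓡 n) (extChartAt (𝓡 n) y).symm z := by
  have := mdifferentiableWithinAt_extChartAt_symm (I := 𝓡 n) hz
  rwa [modelWithCornersSelf_coe, range_id, mdifferentiableWithinAt_univ] at this

theorem chartDiff_chartFrame {y : M} {z : EuclideanSpace ℝ (Fin n)}
    (hz : z ∈ (extChartAt (𝓡 n) y).target) (v : EuclideanSpace ℝ (Fin n)) :
    chartDiff y ((extChartAt (𝓡 n) y).symm z) (chartFrame y z v) = v := by
  have h := mfderiv_extChartAt_comp_mfderivWithin_extChartAt_symm (I := 𝓡 n) hz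
  simp only [modelWithCornersSelf_coe, range_id, mfderivWithin_univ] at h
  exact congrArg (fun L : EuclideanSpace ℝ (Fin n) →L[ℝ] EuclideanSpace ℝ (Fin n) => L v) h

theorem chartFrame_chartDiff {y : M} {z : EuclideanSpace ℝ (Fin n)}
    (hz : z ∈ (extChartAt (𝓡 n) y).target)
    (v : TangentSpace (𝓡 n) ((extChartAt (𝓡 n) y).symm z)) :
    chartFrame y z (chartDiff y ((extChartAt (𝓡 n) y).symm z) v) = v := by
  have h := mfderivWithin_extChartAt_symm_comp_mfderiv_extChartAt (I := 𝓡 n) hz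
  simp only [modelWithCornersSelf_coe, range_id, mfderivWithin_univ] at h
  exact congrArg (fun L : TangentSpace (𝓡 n) ((extChartAt (𝓡 n) y).symm z) →L[ℝ]
    TangentSpace (𝓡 n) ((extChartAt (𝓡 n) y).symm z) => L v) h

/-- This is the tangent map of the inverse chart composed with the constant section `v`. -/
theorem contMDiffOn_chartFrame (y : M) (v : EuclideanSpace ℝ (Fin n)) :
    ContMDiffOn (𝓡 n) (𝓡 n).tangent ∞
      (fun z => TotalSpace.mk' (EuclideanSpace ℝ (Fin n)) ((extChartAt (𝓡 n) y).symm z)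
        (chartFrame y z v) : EuclideanSpace ℝ (Fin n) → TangentBundle (𝓡 n) M)
      (extChartAt (𝓡 n) y).target := by
  have hopen := isOpen_extChartAt_target (I := 𝓡 n) y
  have h := (contMDiffOn_extChartAt_symm (I := 𝓡 n) (n := ∞) y).contMDiffOn_tangentMapWithin
    (m := ∞) (by simp) hopen.uniqueMDiffOn
  have hs : ContMDiff (𝓡 n) (𝓡 n).tangent ∞
      (fun z => TotalSpace.mk' (EuclideanSpace ℝ (Fin n)) z v :
        EuclideanSpace ℝ (Fin n) → TangentBundle (𝓡 n) (EuclideanSpace ℝ (Fin n))) := by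
    intro z
    rw [contMDiffAt_totalSpace]
    refine ⟨contMDiffAt_id, ?_⟩
    simpa using contMDiffAt_const
  have := h.comp (s := (extChartAt (𝓡 n) y).target) hs.contMDiffOn (fun z hz => hz)
  refine this.congr fun z hz => ?_
  simp only [Function.comp_apply, tangentMapWithin, chartFrame,
    mfderivWithin_of_isOpen hopen hz]
  rfl

/-- The metric in the chart centred at `y`, as a bilinear form on `ℝⁿ`. -/
def chartMetric (g : SmoothMetric n M) (y : M) (z : EuclideanSpace ℝ (Fin n)) :
    EuclideanSpace ℝ (Fin n) →L[ℝ] EuclideanSpace ℝ (Fin n) →L[ℝ] ℝ :=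
  ContinuousLinearMap.bilinearComp (E := EuclideanSpace ℝ (Fin n)) (F := EuclideanSpace ℝ (Fin n))
    (g.inner ((extChartAt (𝓡 n) y).symm z)) (chartFrame y z) (chartFrame y z)

theorem chartMetric_apply (g : SmoothMetric n M) (y : M) (z v w : EuclideanSpace ℝ (Fin n)) :
    chartMetric g y z v w =
      g.inner ((extChartAt (𝓡 n) y).symm z) (chartFrame y z v) (chartFrame y z w) := rfl

theorem gramMatrix_apply (g : SmoothMetric n M) (y : M) (z : EuclideanSpace ℝ (Fin n))
    (i j : Fin n) : gramMatrix g y z i j =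
      chartMetric g y z (EuclideanSpace.single i 1) (EuclideanSpace.single j 1) := rfl

theorem contDiffOn_inner_of_contMDiffOn (g : SmoothMetric n M) {s : Set (EuclideanSpace ℝ (Fin n))}
    {b : EuclideanSpace ℝ (Fin n) → M}
    {V W : (z : EuclideanSpace ℝ (Fin n)) → TangentSpace (𝓡 n) (b z)}
    (hV : ContMDiffOn (𝓡 n) (𝓡 n).tangent ∞
      (fun z => TotalSpace.mk' (EuclideanSpace ℝ (Fin n)) (b z) (V z) :
        EuclideanSpace ℝ (Fin n) → TangentBundle (𝓡 n) M) s)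
    (hW : ContMDiffOn (𝓡 n) (𝓡 n).tangent ∞
      (fun z => TotalSpace.mk' (EuclideanSpace ℝ (Fin n)) (b z) (W z) :
        EuclideanSpace ℝ (Fin n) → TangentBundle (𝓡 n) M) s) :
    ContDiffOn ℝ ∞ (fun z => g.inner (b z) (V z) (W z)) s := by
  let _ : RiemannianBundle (fun x : M => TangentSpace (𝓡 n) x) := ⟨g.toRiemannianMetric⟩
  have := ContMDiffOn.inner_bundle (IB := 𝓡 n) (n := ∞) (F := EuclideanSpace ℝ (Fin n))
    (E := fun x : M => TangentSpace (𝓡 n) x) (IM := 𝓡 n) hV hW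
  exact this.contDiffOn

theorem contDiffOn_clm_of_apply {F G : Type*} [NormedAddCommGroup F] [NormedSpace ℝ F]
    [NormedAddCommGroup G] [NormedSpace ℝ G] [FiniteDimensional ℝ F]
    {H : Type*} [NormedAddCommGroup H] [NormedSpace ℝ H] {f : G → F →L[ℝ] H} {s : Set G}
    (h : ∀ v, ContDiffOn ℝ ∞ (fun z => f z v) s) : ContDiffOn ℝ ∞ f s :=
  contDiffOn_clm_apply.2 h

theorem contDiffOn_chartMetric (g : SmoothMetric n M) (y : M) :
    ContDiffOn ℝ ∞ (chartMetric g y) (extChartAt (𝓡 n) y).target := by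
  refine contDiffOn_clm_of_apply fun v => contDiffOn_clm_of_apply fun w => ?_
  simp only [chartMetric_apply]
  exact contDiffOn_inner_of_contMDiffOn g (contMDiffOn_chartFrame y v) (contMDiffOn_chartFrame y w)

theorem chartMetric_symm (g : SmoothMetric n M) (y : M) (z v w : EuclideanSpace ℝ (Fin n)) :
    chartMetric g y z v w = chartMetric g y z w v := g.symm _ _ _

theorem chartMetric_pos (g : SmoothMetric n M) {y : M} {z : EuclideanSpace ℝ (Fin n)}
    (hz : z ∈ (extChartAt (𝓡 n) y).target) {v : EuclideanSpace ℝ (Fin n)} (hv : v ≠ 0) :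
    0 < chartMetric g y z v v := by
  rw [chartMetric_apply]
  refine g.pos _ _ fun h => hv ?_
  rw [← chartDiff_chartFrame hz v, h, map_zero]

theorem isInvertible_of_pos {F : Type*} [NormedAddCommGroup F] [NormedSpace ℝ F]
    [FiniteDimensional ℝ F] (B : F →L[ℝ] F →L[ℝ] ℝ) (hB : ∀ v, v ≠ 0 → 0 < B v v) :
    B.IsInvertible := by
  have hinj : Function.Injective B.toLinearMap := by
    rw [injective_iff_map_eq_zero]
    intro v hv
    by_contra hne
    have := hB v hne
    have h0 : B v = 0 := hv
    simp [h0] at this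
  have hdim : Module.finrank ℝ F = Module.finrank ℝ (F →L[ℝ] ℝ) := by
    rw [← LinearEquiv.finrank_eq (LinearMap.toContinuousLinearMap (𝕜 := ℝ) (E := F) (F' := ℝ))]
    exact (Subspace.dual_finrank_eq (K := ℝ) (V := F)).symm
  refine ⟨(LinearEquiv.ofInjectiveOfFinrankEq B.toLinearMap hinj hdim).toContinuousLinearEquiv, ?_⟩
  ext v w
  rfl

theorem isInvertible_chartMetric (g : SmoothMetric n M) {y : M} {z : EuclideanSpace ℝ (Fin n)}
    (hz : z ∈ (extChartAt (𝓡 n) y).target) : (chartMetric g y z).IsInvertible :=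
  isInvertible_of_pos _ fun _ hv => chartMetric_pos g hz hv

theorem isInvertible_inner (g : SmoothMetric n M) (x : M) : (g.inner x).IsInvertible :=
  isInvertible_of_pos (F := EuclideanSpace ℝ (Fin n)) (g.inner x) (g.pos x)

theorem inner_grad (g : SmoothMetric n M) (w : M → ℝ) (x : M) (v : TangentSpace (𝓡 n) x) :
    g.inner x (grad g w x) v = mfderiv (𝓡 n) 𝓘(ℝ) w x v :=
  congrArg (fun L : TangentSpace (𝓡 n) x →L[ℝ] ℝ => L v)
    ((isInvertible_inner g x).self_apply_inverse _)

theorem posDef_gramMatrix (g : SmoothMetric n M) {y : M} {z : EuclideanSpace ℝ (Fin n)}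
    (hz : z ∈ (extChartAt (𝓡 n) y).target) : (gramMatrix g y z).PosDef := by
  refine Matrix.PosDef.of_dotProduct_mulVec_pos ?_ fun x hx => ?_
  · ext i j
    simp only [Matrix.conjTranspose_apply, gramMatrix_apply, star_trivial]
    exact chartMetric_symm g y z _ _
  · have hx' : WithLp.toLp 2 x ≠ 0 := by simpa using hx
    have hsum : (WithLp.toLp 2 x : EuclideanSpace ℝ (Fin n)) =
        ∑ i, x i • EuclideanSpace.single i (1 : ℝ) := by
      ext j
      simp [Finset.sum_apply, Pi.single_apply]
    have := chartMetric_pos g hz hx'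
    rw [hsum] at this
    simp only [map_sum, map_smul, sum_apply, smul_apply,
      smul_eq_mul] at this
    refine this.trans_eq ?_
    simp only [dotProduct, Matrix.mulVec, gramMatrix_apply, star_trivial, Finset.mul_sum]
    exact Finset.sum_congr rfl fun i _ => Finset.sum_congr rfl fun j _ => by
      rw [chartMetric_symm g y z (.single j 1)]; ring

theorem volDensity_pos (g : SmoothMetric n M) {y : M} {z : EuclideanSpace ℝ (Fin n)}
    (hz : z ∈ (extChartAt (𝓡 n) y).target) : 0 < volDensity g y z :=
  Real.sqrt_pos.2 (posDef_gramMatrix g hz).det_pos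

theorem contDiffOn_volDensity (g : SmoothMetric n M) (y : M) :
    ContDiffOn ℝ ∞ (volDensity g y) (extChartAt (𝓡 n) y).target := by
  refine ContDiffOn.sqrt ?_ fun z hz => (posDef_gramMatrix g hz).det_pos.ne'
  simp only [Matrix.det_apply, gramMatrix_apply]
  refine ContDiffOn.sum fun σ _ => ContDiffOn.const_smul _ ?_
  refine contDiffOn_prod fun i _ => ?_
  exact ((contDiffOn_chartMetric g y).clm_apply contDiffOn_const).clm_apply contDiffOn_const

/-- A `(1,1)`-tensor field in the chart centred at `y`. -/
def chartTensor (T : (x : M) → TangentSpace (𝓡 n) x →L[ℝ] TangentSpace (𝓡 n) x) (y : M)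
    (z : EuclideanSpace ℝ (Fin n)) : EuclideanSpace ℝ (Fin n) →L[ℝ] EuclideanSpace ℝ (Fin n) :=
  (chartDiff y ((extChartAt (𝓡 n) y).symm z)).comp
    ((T ((extChartAt (𝓡 n) y).symm z)).comp (chartFrame y z))

/-- The components of a vector field in the chart centred at `y`. -/
def chartField (X : (x : M) → TangentSpace (𝓡 n) x) (y : M) (z : EuclideanSpace ℝ (Fin n)) :
    EuclideanSpace ℝ (Fin n) :=
  chartDiff y ((extChartAt (𝓡 n) y).symm z) (X ((extChartAt (𝓡 n) y).symm z))

/-- The coefficients `g(T ∂_v, ∂_w)` are smooth by bundle calculus; raising an index with the smooth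
inverse metric recovers the components of `T`. -/
theorem contDiffOn_chartTensor (g : SmoothMetric n M)
    {T : (x : M) → TangentSpace (𝓡 n) x →L[ℝ] TangentSpace (𝓡 n) x}
    (hT : IsSymmPosTensor g T) (y : M) :
    ContDiffOn ℝ ∞ (chartTensor T y) (extChartAt (𝓡 n) y).target := by
  set s := (extChartAt (𝓡 n) y).target
  have key : ∀ v, ContDiffOn ℝ ∞ (fun z => chartMetric g y z (chartTensor T y z v)) s := by
    refine fun v => contDiffOn_clm_of_apply fun w => ?_
    have hTv : ContMDiffOn (𝓡 n) (𝓡 n).tangent ∞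
        (fun z => TotalSpace.mk' (EuclideanSpace ℝ (Fin n)) ((extChartAt (𝓡 n) y).symm z)
          (T _ (chartFrame y z v)) : EuclideanSpace ℝ (Fin n) → TangentBundle (𝓡 n) M) s := by
      refine ContMDiffOn.clm_bundle_apply (F₁ := EuclideanSpace ℝ (Fin n))
        (E₁ := fun x : M => TangentSpace (𝓡 n) x)
        (b := fun z => (extChartAt (𝓡 n) y).symm z) (ϕ := fun z => T _)
        ?_ (contMDiffOn_chartFrame y v)
      exact hT.contMDiff.comp_contMDiffOn (contMDiffOn_extChartAt_symm y)
    refine (contDiffOn_inner_of_contMDiffOn g hTv (contMDiffOn_chartFrame y w)).congr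
      fun z hz => ?_
    simp only [chartMetric_apply, chartTensor, ContinuousLinearMap.comp_apply,
      chartFrame_chartDiff hz]
  refine contDiffOn_clm_of_apply fun v => ?_
  have hinv : ContDiffOn ℝ ∞ (fun z => (chartMetric g y z).inverse) s := fun z hz =>
    (isInvertible_chartMetric g hz).contDiffAt_map_inverse.comp_contDiffWithinAt z
      (contDiffOn_chartMetric g y z hz)
  refine (hinv.clm_apply (key v)).congr fun z hz => ?_
  exact ((isInvertible_chartMetric g hz).inverse_apply_self _).symm

theorem contDiffOn_chartMetric_inverse (g : SmoothMetric n M) (y : M) :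
    ContDiffOn ℝ ∞ (fun z => (chartMetric g y z).inverse) (extChartAt (𝓡 n) y).target :=
  fun z hz => (isInvertible_chartMetric g hz).contDiffAt_map_inverse.comp_contDiffWithinAt z
    (contDiffOn_chartMetric g y z hz)

theorem fderiv_comp_extChartAt_symm {y : M} {z : EuclideanSpace ℝ (Fin n)}
    (hz : z ∈ (extChartAt (𝓡 n) y).target) {w : M → ℝ}
    (hw : MDifferentiableAt (𝓡 n) 𝓘(ℝ) w ((extChartAt (𝓡 n) y).symm z))
    (v : EuclideanSpace ℝ (Fin n)) :
    fderiv ℝ (fun z => w ((extChartAt (𝓡 n) y).symm z)) z v =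
      mfderiv (𝓡 n) 𝓘(ℝ) w ((extChartAt (𝓡 n) y).symm z) (chartFrame y z v) := by
  have h := mfderiv_comp (I := 𝓡 n) z hw (mdifferentiableAt_extChartAt_symm hz)
  rw [mfderiv_eq_fderiv] at h
  exact congrArg (fun L : EuclideanSpace ℝ (Fin n) →L[ℝ] ℝ => L v) h

theorem fderiv_chartField {y : M} {z : EuclideanSpace ℝ (Fin n)}
    (hz : z ∈ (extChartAt (𝓡 n) y).target) {w : M → ℝ}
    (hw : MDifferentiableAt (𝓡 n) 𝓘(ℝ) w ((extChartAt (𝓡 n) y).symm z))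
    (X : (x : M) → TangentSpace (𝓡 n) x) :
    fderiv ℝ (fun z => w ((extChartAt (𝓡 n) y).symm z)) z (chartField X y z) =
      mfderiv (𝓡 n) 𝓘(ℝ) w ((extChartAt (𝓡 n) y).symm z) (X _) := by
  rw [fderiv_comp_extChartAt_symm hz hw, chartField, chartFrame_chartDiff hz]

/-- The map that takes the differential of `w` to `T ∇w`, in the chart centred at `y`. -/
def chartFlux (g : SmoothMetric n M)
    (T : (x : M) → TangentSpace (𝓡 n) x →L[ℝ] TangentSpace (𝓡 n) x) (y : M)
    (z : EuclideanSpace ℝ (Fin n)) :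
    (EuclideanSpace ℝ (Fin n) →L[ℝ] ℝ) →L[ℝ] EuclideanSpace ℝ (Fin n) :=
  (chartTensor T y z).comp (chartMetric g y z).inverse

theorem contDiffOn_chartFlux (g : SmoothMetric n M)
    {T : (x : M) → TangentSpace (𝓡 n) x →L[ℝ] TangentSpace (𝓡 n) x}
    (hT : IsSymmPosTensor g T) (y : M) :
    ContDiffOn ℝ ∞ (chartFlux g T y) (extChartAt (𝓡 n) y).target :=
  (contDiffOn_chartTensor g hT y).clm_comp (contDiffOn_chartMetric_inverse g y)

/-- In coordinates `T∇w` is a smooth matrix field applied to the differential of `w`, so its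
regularity in space and time is that of the differential. -/
theorem chartField_flux (g : SmoothMetric n M)
    (T : (x : M) → TangentSpace (𝓡 n) x →L[ℝ] TangentSpace (𝓡 n) x)
    {y : M} {z : EuclideanSpace ℝ (Fin n)}
    (hz : z ∈ (extChartAt (𝓡 n) y).target) {w : M → ℝ}
    (hw : MDifferentiableAt (𝓡 n) 𝓘(ℝ) w ((extChartAt (𝓡 n) y).symm z)) :
    chartField (fun x => T x (grad g w x)) y z =
      chartFlux g T y z (fderiv ℝ (fun z => w ((extChartAt (𝓡 n) y).symm z)) z) := by
  have hgrad : (chartMetric g y z).inverse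
      (fderiv ℝ (fun z => w ((extChartAt (𝓡 n) y).symm z)) z) = chartField (grad g w) y z := by
    have : fderiv ℝ (fun z => w ((extChartAt (𝓡 n) y).symm z)) z =
        chartMetric g y z (chartField (grad g w) y z) := by
      ext v
      rw [fderiv_comp_extChartAt_symm hz hw, chartMetric_apply, chartField,
        chartFrame_chartDiff hz, inner_grad]
    rw [this]
    exact (isInvertible_chartMetric g hz).inverse_apply_self _
  rw [chartFlux, ContinuousLinearMap.comp_apply, hgrad]
  simp only [chartField, chartTensor, ContinuousLinearMap.comp_apply, chartFrame_chartDiff hz]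

end ChartCalculus

/-! ### The Riemannian volume in charts -/

section Volume

variable {n : ℕ} {M : Type*} [TopologicalSpace M] [ChartedSpace (EuclideanSpace ℝ (Fin n)) M]
  [IsManifold (𝓡 n) ∞ M]

theorem chartMetric_chartDiff (g : SmoothMetric n M) {y x : M}
    (hx : x ∈ (extChartAt (𝓡 n) y).source) (v w : TangentSpace (𝓡 n) x) :
    chartMetric g y (extChartAt (𝓡 n) y x) (chartDiff y x v) (chartDiff y x w) =
      g.inner x v w := by
  obtain ⟨z, hz, rfl⟩ : ∃ z ∈ (extChartAt (𝓡 n) y).target, (extChartAt (𝓡 n) y).symm z = x :=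
    ⟨_, (extChartAt (𝓡 n) y).map_source hx, (extChartAt (𝓡 n) y).left_inv hx⟩
  rw [(extChartAt (𝓡 n) y).right_inv hz, chartMetric_apply, chartFrame_chartDiff hz,
    chartFrame_chartDiff hz]

/-- The derivative at `z` of the transition map from the chart at `y` to the chart at `y'`. -/
def transitionDeriv (y y' : M) (z : EuclideanSpace ℝ (Fin n)) :
    EuclideanSpace ℝ (Fin n) →L[ℝ] EuclideanSpace ℝ (Fin n) :=
  (chartDiff y' ((extChartAt (𝓡 n) y).symm z)).comp (chartFrame y z)

theorem hasFDerivAt_transition {y y' : M} {z : EuclideanSpace ℝ (Fin n)}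
    (hz : z ∈ (extChartAt (𝓡 n) y).target)
    (hz' : (extChartAt (𝓡 n) y).symm z ∈ (extChartAt (𝓡 n) y').source) :
    HasFDerivAt (fun z => extChartAt (𝓡 n) y' ((extChartAt (𝓡 n) y).symm z))
      (transitionDeriv y y' z) z := by
  have h1 := (mdifferentiableAt_extChartAt_symm hz).hasMFDerivAt
  have h2 := (mdifferentiableAt_extChartAt (I := 𝓡 n)
    (by rwa [extChartAt_source] at hz')).hasMFDerivAt
  have h := HasMFDerivAt.comp z h2 h1
  exact h.hasFDerivAt

theorem chartMetric_transition (g : SmoothMetric n M) {y y' : M} {z : EuclideanSpace ℝ (Fin n)}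
    (hz' : (extChartAt (𝓡 n) y).symm z ∈ (extChartAt (𝓡 n) y').source)
    (v w : EuclideanSpace ℝ (Fin n)) :
    chartMetric g y' (extChartAt (𝓡 n) y' ((extChartAt (𝓡 n) y).symm z))
      (transitionDeriv y y' z v) (transitionDeriv y y' z w) = chartMetric g y z v w :=
  chartMetric_chartDiff g hz' _ _

theorem gramMatrix_eq_toMatrix (g : SmoothMetric n M) (y : M) (z : EuclideanSpace ℝ (Fin n)) :
    gramMatrix g y z = LinearMap.toMatrix₂ (EuclideanSpace.basisFun (Fin n) ℝ).toBasis
      (EuclideanSpace.basisFun (Fin n) ℝ).toBasis (chartMetric g y z).toLinearMap₁₂ := by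
  ext i j
  rw [LinearMap.toMatrix₂_apply, gramMatrix_apply]
  simp

/-- The Gram matrices are related by `G = Jᵀ G' J` with `J` the Jacobian of the transition map; take
determinants and square roots. -/
theorem volDensity_transition (g : SmoothMetric n M) {y y' : M} {z : EuclideanSpace ℝ (Fin n)}
    (hz' : (extChartAt (𝓡 n) y).symm z ∈ (extChartAt (𝓡 n) y').source) :
    volDensity g y z = |(transitionDeriv y y' z).det| *
      volDensity g y' (extChartAt (𝓡 n) y' ((extChartAt (𝓡 n) y).symm z)) := by
  set b := (EuclideanSpace.basisFun (Fin n) ℝ).toBasis with hb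
  have h : gramMatrix g y z = (LinearMap.toMatrix b b (transitionDeriv y y' z)).transpose *
      gramMatrix g y' (extChartAt (𝓡 n) y' ((extChartAt (𝓡 n) y).symm z)) *
      LinearMap.toMatrix b b (transitionDeriv y y' z) := by
    rw [gramMatrix_eq_toMatrix, gramMatrix_eq_toMatrix, ← hb, ← LinearMap.toMatrix₂_compl₁₂]
    congr 1
    ext v w
    exact (chartMetric_transition g hz' v w).symm
  rw [volDensity, volDensity, h, Matrix.det_mul, Matrix.det_mul, Matrix.det_transpose,
    LinearMap.det_toMatrix, ← Real.sqrt_sq_eq_abs, ← Real.sqrt_mul (sq_nonneg _)]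
  congr 1
  simp only [ContinuousLinearMap.det]
  ring

variable [MeasurableSpace M] [BorelSpace M]

theorem aemeasurable_extChartAt_symm (y : M) :
    AEMeasurable (extChartAt (𝓡 n) y).symm (volume.restrict (extChartAt (𝓡 n) y).target) :=
  (continuousOn_extChartAt_symm y).aemeasurable (isOpen_extChartAt_target y).measurableSet

theorem aemeasurable_ofReal_volDensity (g : SmoothMetric n M) (y : M) :
    AEMeasurable (fun z => ENNReal.ofReal (volDensity g y z))
      (volume.restrict (extChartAt (𝓡 n) y).target) :=
  ((contDiffOn_volDensity g y).continuousOn.aemeasurable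
    (isOpen_extChartAt_target y).measurableSet).ennreal_ofReal

theorem chartVolume_apply (g : SmoothMetric n M) (y : M) {B : Set M} (hB : MeasurableSet B) :
    chartVolume g y B = ∫⁻ z in (extChartAt (𝓡 n) y).target ∩ (extChartAt (𝓡 n) y).symm ⁻¹' B,
      ENNReal.ofReal (volDensity g y z) := by
  rw [chartVolume, Measure.map_apply_of_aemeasurable _ hB, withDensity_apply',
    Measure.restrict_restrict' (isOpen_extChartAt_target y).measurableSet, inter_comm]
  exact (aemeasurable_extChartAt_symm y).mono_ac (withDensity_absolutelyContinuous _ _)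

theorem measurableSet_target_inter_preimage (y : M) {B : Set M} (hB : MeasurableSet B) :
    MeasurableSet ((extChartAt (𝓡 n) y).target ∩ (extChartAt (𝓡 n) y).symm ⁻¹' B) := by
  have hm := (isOpen_extChartAt_target (I := 𝓡 n) y).measurableSet
  have hc := (continuousOn_extChartAt_symm (I := 𝓡 n) y).domRestrict.measurable
  have := hm.subtype_image (hc hB)
  convert! this using 1
  ext z
  simp [and_comm]

/-- Change of variables along the transition map, whose Jacobian is absorbed by
`volDensity_transition`. -/
theorem chartVolume_congr (g : SmoothMetric n M) {y y' : M} {B : Set M} (hB : MeasurableSet B)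
    (h : B ⊆ (extChartAt (𝓡 n) y).source) (h' : B ⊆ (extChartAt (𝓡 n) y').source) :
    chartVolume g y B = chartVolume g y' B := by
  rw [chartVolume_apply g y hB, chartVolume_apply g y' hB]
  set S := (extChartAt (𝓡 n) y).target ∩ (extChartAt (𝓡 n) y).symm ⁻¹' B with hS
  set τ := fun z => extChartAt (𝓡 n) y' ((extChartAt (𝓡 n) y).symm z) with hτ
  have himage : (extChartAt (𝓡 n) y').target ∩ (extChartAt (𝓡 n) y').symm ⁻¹' B = τ '' S := by
    ext z
    constructor
    · rintro ⟨hz, hzB⟩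
      refine ⟨extChartAt (𝓡 n) y ((extChartAt (𝓡 n) y').symm z),
        ⟨(extChartAt (𝓡 n) y).map_source (h hzB), ?_⟩, ?_⟩
      · simpa only [mem_preimage, (extChartAt (𝓡 n) y).left_inv (h hzB)] using hzB
      · simp only [hτ, (extChartAt (𝓡 n) y).left_inv (h hzB), (extChartAt (𝓡 n) y').right_inv hz]
    · rintro ⟨z, ⟨hz, hzB⟩, rfl⟩
      refine ⟨(extChartAt (𝓡 n) y').map_source (h' hzB), ?_⟩
      simpa only [mem_preimage, hτ, (extChartAt (𝓡 n) y').left_inv (h' hzB)] using hzB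
  have hinj : InjOn τ S := by
    rintro z ⟨hz, hzB⟩ w ⟨hw, hwB⟩ hzw
    exact (extChartAt (𝓡 n) y).symm.injOn hz hw
      ((extChartAt (𝓡 n) y').injOn (h' hzB) (h' hwB) hzw)
  have hmS : MeasurableSet S := measurableSet_target_inter_preimage y hB
  rw [himage, lintegral_image_eq_lintegral_abs_det_fderiv_mul volume hmS
    (fun z hz => (hasFDerivAt_transition hz.1 (h' hz.2)).hasFDerivWithinAt) hinj]
  refine setLIntegral_congr_fun hmS fun z hz => ?_
  rw [volDensity_transition g (h' hz.2), ENNReal.ofReal_mul (abs_nonneg _)]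

theorem chartVolume_inter_source (g : SmoothMetric n M) (y : M) {B : Set M}
    (hB : MeasurableSet B) :
    chartVolume g y (B ∩ (extChartAt (𝓡 n) y).source) = chartVolume g y B := by
  rw [chartVolume_apply g y hB,
    chartVolume_apply g y (hB.inter (isOpen_extChartAt_source y).measurableSet)]
  congr 2
  ext z
  simp only [mem_inter_iff, mem_preimage]
  exact ⟨fun h => ⟨h.1, h.2.1⟩, fun h => ⟨h.1, h.2, (extChartAt (𝓡 n) y).map_target h.1⟩⟩

theorem chartVolume_le_riemannianVolume (g : SmoothMetric n M) (y : M) :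
    chartVolume g y ≤ riemannianVolume g := le_iSup (chartVolume g) y

theorem riemannianVolume_apply (g : SmoothMetric n M) {y : M} {B : Set M} (hB : MeasurableSet B)
    (h : B ⊆ (extChartAt (𝓡 n) y).source) : riemannianVolume g B = chartVolume g y B := by
  refine le_antisymm ?_ (chartVolume_le_riemannianVolume g y B)
  set s := (extChartAt (𝓡 n) y).source
  have hs : MeasurableSet s := (isOpen_extChartAt_source y).measurableSet
  -- By minimality of the supremum it suffices that the right side dominates each chart volume.
  -- Inside `s` this is agreement on overlaps, outside it is the definition of the supremum.
  have hle : riemannianVolume g ≤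
      (chartVolume g y).restrict s + (riemannianVolume g).restrict sᶜ := by
    refine iSup_le fun y' => Measure.le_iff.2 fun A hA => ?_
    rw [Measure.add_apply, Measure.restrict_apply hA, Measure.restrict_apply hA,
      ← measure_inter_add_sdiff A hs, sdiff_eq]
    refine add_le_add ?_ (chartVolume_le_riemannianVolume g y' _)
    rw [← chartVolume_inter_source g y' (hA.inter hs)]
    rw [← chartVolume_congr g (y := y)
      ((hA.inter hs).inter (isOpen_extChartAt_source y').measurableSet)
      (fun x hx => hx.1.2) (fun x hx => hx.2)]
    exact measure_mono inter_subset_left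
  refine (hle B).trans ?_
  rw [Measure.add_apply, Measure.restrict_apply hB, Measure.restrict_apply hB,
    inter_eq_self_of_subset_left h, ← sdiff_eq, sdiff_eq_empty.2 h, measure_empty, add_zero]

theorem riemannianVolume_restrict_source (g : SmoothMetric n M) (y : M) :
    (riemannianVolume g).restrict (extChartAt (𝓡 n) y).source = chartVolume g y := by
  ext B hB
  rw [Measure.restrict_apply hB, riemannianVolume_apply g
    (hB.inter (isOpen_extChartAt_source y).measurableSet) inter_subset_right,
    chartVolume_inter_source g y hB]

theorem setIntegral_source_eq (g : SmoothMetric n M) (y : M) {q : M → ℝ}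
    (hq : ContinuousOn q (extChartAt (𝓡 n) y).source) :
    ∫ x in (extChartAt (𝓡 n) y).source, q x ∂(riemannianVolume g) =
      ∫ z in (extChartAt (𝓡 n) y).target,
        volDensity g y z * q ((extChartAt (𝓡 n) y).symm z) := by
  have hm : AEStronglyMeasurable q (chartVolume g y) := by
    rw [← riemannianVolume_restrict_source]
    exact hq.aestronglyMeasurable (isOpen_extChartAt_source y).measurableSet
  rw [riemannianVolume_restrict_source]
  rw [chartVolume] at hm ⊢
  rw [integral_map ((aemeasurable_extChartAt_symm y).mono_ac
    (withDensity_absolutelyContinuous _ _)) hm,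
    integral_withDensity_eq_integral_toReal_smul₀ (aemeasurable_ofReal_volDensity g y)
    (by simp)]
  refine setIntegral_congr_fun (isOpen_extChartAt_target y).measurableSet fun z hz => ?_
  simp only [ENNReal.toReal_ofReal (volDensity_pos g hz).le, smul_eq_mul]

instance isLocallyFiniteMeasure_riemannianVolume (g : SmoothMetric n M) :
    IsLocallyFiniteMeasure (riemannianVolume g) := by
  refine ⟨fun y => ?_⟩
  have hopen := isOpen_extChartAt_target (I := 𝓡 n) y
  obtain ⟨r, hr, hball⟩ := Metric.nhds_basis_closedBall.mem_iff.1
    (hopen.mem_nhds (mem_extChartAt_target (I := 𝓡 n) y))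
  obtain ⟨C, hC⟩ := (isCompact_closedBall (extChartAt (𝓡 n) y y) r).exists_bound_of_continuousOn
    ((contDiffOn_volDensity g y).continuousOn.mono hball)
  have hW : IsOpen ((extChartAt (𝓡 n) y).source ∩
      extChartAt (𝓡 n) y ⁻¹' Metric.ball (extChartAt (𝓡 n) y y) r) :=
    (continuousOn_extChartAt y).isOpen_inter_preimage (isOpen_extChartAt_source y)
      Metric.isOpen_ball
  refine ⟨_, hW.mem_nhds ⟨mem_extChartAt_source y, Metric.mem_ball_self hr⟩, ?_⟩
  rw [riemannianVolume_apply g hW.measurableSet inter_subset_left,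
    chartVolume_apply g y hW.measurableSet]
  calc _ ≤ ∫⁻ z in Metric.closedBall (extChartAt (𝓡 n) y y) r,
        ENNReal.ofReal (volDensity g y z) := by
        refine lintegral_mono_set ?_
        rintro z ⟨hz, -, hzb⟩
        rw [mem_preimage, (extChartAt (𝓡 n) y).right_inv hz] at hzb
        exact Metric.ball_subset_closedBall hzb
    _ ≤ ∫⁻ z in Metric.closedBall (extChartAt (𝓡 n) y y) r, ENNReal.ofReal C := by
        refine setLIntegral_mono measurable_const fun z hz => ENNReal.ofReal_le_ofReal ?_
        exact (le_abs_self _).trans (hC z hz)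
    _ < ⊤ := by
        rw [setLIntegral_const]
        exact ENNReal.mul_lt_top ENNReal.ofReal_lt_top
          (isCompact_closedBall _ _).measure_lt_top

instance isOpenPosMeasure_riemannianVolume (g : SmoothMetric n M) :
    (riemannianVolume g).IsOpenPosMeasure := by
  refine ⟨fun O hO ⟨y, hy⟩ h0 => ?_⟩
  have h1 : chartVolume g y O = 0 :=
    le_antisymm ((chartVolume_le_riemannianVolume g y O).trans h0.le) bot_le
  rw [chartVolume_apply g y hO.measurableSet] at h1
  have hS : IsOpen ((extChartAt (𝓡 n) y).target ∩ (extChartAt (𝓡 n) y).symm ⁻¹' O) :=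
    (continuousOn_extChartAt_symm y).isOpen_inter_preimage (isOpen_extChartAt_target y) hO
  rw [lintegral_eq_zero_iff' ((aemeasurable_ofReal_volDensity g y).mono_set inter_subset_left),
    Filter.EventuallyEq, ae_restrict_iff' hS.measurableSet] at h1
  -- A positive density with zero integral leaves only a Lebesgue null set, but the coordinate image
  -- of `O` is open and nonempty.
  have h2 : (volume : Measure (EuclideanSpace ℝ (Fin n)))
      ((extChartAt (𝓡 n) y).target ∩ (extChartAt (𝓡 n) y).symm ⁻¹' O) = 0 := by
    refine measure_mono_null (fun z hz => ?_) h1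
    simp only [mem_compl_iff, mem_ofPred_eq, Pi.zero_apply, ENNReal.ofReal_eq_zero, not_forall]
    exact ⟨hz, (volDensity_pos g hz.1).not_ge⟩
  refine (hS.measure_pos volume ⟨extChartAt (𝓡 n) y y, mem_extChartAt_target y, ?_⟩).ne' h2
  rw [mem_preimage, extChartAt_to_inv]
  exact hy

end Volume

/-! ### The divergence theorem -/

section EuclideanParts

/-- The integral of a directional derivative of a compactly supported function over an open set
vanishes. -/
theorem setIntegral_fderiv_eq_zero {E : Type*} [NormedAddCommGroup E] [NormedSpace ℝ E]
    [FiniteDimensional ℝ E] [MeasurableSpace E] [BorelSpace E] {μ : Measure E}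
    [μ.IsAddHaarMeasure] {V K : Set E} (hV : IsOpen V) (hK : IsCompact K) (hKV : K ⊆ V)
    {F : E → ℝ} (hF : ContDiffOn ℝ 1 F V) (h0 : ∀ z ∈ V, z ∉ K → F z = 0) (v : E) :
    ∫ z in V, fderiv ℝ F z v ∂μ = 0 := by
  -- Extension by zero is `C¹` on the whole space because `F` vanishes off the compact `K ⊆ V`; the
  -- claim is then integration by parts against the constant `1`.
  set G : E → ℝ := V.indicator F with hG
  have hGV : ∀ z ∈ V, G =ᶠ[nhds z] F := fun z hz => by
    filter_upwards [hV.mem_nhds hz] with w hw using indicator_of_mem hw F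
  have hG0 : ∀ z ∉ K, G z = 0 := fun z hz => by
    by_cases hzV : z ∈ V
    · rw [hG, indicator_of_mem hzV, h0 z hzV hz]
    · rw [hG, indicator_of_notMem hzV]
  have hGK : ∀ z ∉ K, G =ᶠ[nhds z] fun _ => 0 := fun z hz => by
    filter_upwards [hK.isClosed.isOpen_compl.mem_nhds hz] with w hw using hG0 w hw
  have hGC : ContDiff ℝ 1 G := by
    refine contDiff_iff_contDiffAt.2 fun z => ?_
    by_cases hz : z ∈ K
    · exact ((hF.contDiffAt (hV.mem_nhds (hKV hz)))).congr_of_eventuallyEq (hGV z (hKV hz))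
    · exact contDiffAt_const.congr_of_eventuallyEq (hGK z hz)
  have hcs : HasCompactSupport G := HasCompactSupport.intro hK hG0
  have hcont : Continuous fun z => fderiv ℝ G z v :=
    (hGC.continuous_fderiv (by simp)).clm_apply continuous_const
  have hint' : Integrable (fun z => fderiv ℝ G z v) μ :=
    hcont.integrable_of_hasCompactSupport (hcs.fderiv_apply ℝ v)
  have hmain := integral_mul_fderiv_eq_neg_fderiv_mul_of_integrable (μ := μ) (f := fun _ : E => (1:ℝ))
    (g := G) (v := v) (by simp) (by simpa using hint')
    (by simpa using hGC.continuous.integrable_of_hasCompactSupport hcs)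
    (fun z _ => differentiableAt_const _)
    (fun z _ => (hGC.differentiable (by simp)) z)
  simp only [one_mul, fderiv_fun_const, Pi.zero_apply, zero_apply, zero_mul,
    integral_zero, neg_zero] at hmain
  rw [← setIntegral_eq_integral_of_forall_compl_eq_zero (s := V) (fun z hz => ?_)] at hmain
  · rw [← hmain]
    exact setIntegral_congr_fun hV.measurableSet fun z hz => by
      simp only [(hGV z hz).fderiv_eq]
  · rw [(hGK z fun h => hz (hKV h)).fderiv_eq]
    simp

theorem fderiv_apply_eq_sum {n : ℕ} (L : EuclideanSpace ℝ (Fin n) →L[ℝ] ℝ)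
    (v : EuclideanSpace ℝ (Fin n)) :
    L v = ∑ i, v i * L (EuclideanSpace.single i 1) := by
  have hsum : v = ∑ i, v i • EuclideanSpace.single i (1 : ℝ) := by
    ext j
    simp [Finset.sum_apply, Pi.single_apply]
  conv_lhs => rw [hsum]
  simp

end EuclideanParts

/-! ### The divergence in charts, its chart independence, and the global theorem. -/

section Divergence

variable {n : ℕ} {M : Type*} [TopologicalSpace M] [ChartedSpace (EuclideanSpace ℝ (Fin n)) M]
  [IsManifold (𝓡 n) ∞ M]

/-- The divergence of a vector field, computed in the chart centred at `y`. -/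
def chartDivergence (g : SmoothMetric n M) (X : (x : M) → TangentSpace (𝓡 n) x) (y : M)
    (z : EuclideanSpace ℝ (Fin n)) : ℝ :=
  (volDensity g y z)⁻¹ * ∑ i : Fin n,
    fderiv ℝ (fun z => volDensity g y z * chartField X y z i) z (EuclideanSpace.single i (1 : ℝ))

/-- A vector field all of whose chart representations are `C¹`. -/
def IsC1Field (X : (x : M) → TangentSpace (𝓡 n) x) : Prop :=
  ∀ y : M, ContDiffOn ℝ 1 (chartField X y) (extChartAt (𝓡 n) y).target

/-- The derivative of `φ` along the vector field `X`. -/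
def dirDeriv (φ : M → ℝ) (X : (x : M) → TangentSpace (𝓡 n) x) (x : M) : ℝ :=
  mfderiv (𝓡 n) 𝓘(ℝ) φ x (X x)

variable {g : SmoothMetric n M} {X : (x : M) → TangentSpace (𝓡 n) x} {φ : M → ℝ}

theorem dirDeriv_eq_fderiv {y x : M} (hx : x ∈ (extChartAt (𝓡 n) y).source)
    (hφ : MDifferentiableAt (𝓡 n) 𝓘(ℝ) φ x) :
    dirDeriv φ X x = fderiv ℝ (fun z => φ ((extChartAt (𝓡 n) y).symm z))
      (extChartAt (𝓡 n) y x) (chartField X y (extChartAt (𝓡 n) y x)) := by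
  obtain ⟨z, hz, rfl⟩ : ∃ z ∈ (extChartAt (𝓡 n) y).target, (extChartAt (𝓡 n) y).symm z = x :=
    ⟨_, (extChartAt (𝓡 n) y).map_source hx, (extChartAt (𝓡 n) y).left_inv hx⟩
  rw [(extChartAt (𝓡 n) y).right_inv hz, fderiv_chartField hz hφ]
  rfl

theorem contDiffOn_comp_symm {k : WithTop ℕ∞} (hk : k ≤ ∞) {F : Type*} [NormedAddCommGroup F]
    [NormedSpace ℝ F] {w : M → F}
    (hw : ContMDiff (𝓡 n) 𝓘(ℝ, F) k w) (y : M) :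
    ContDiffOn ℝ k (fun z => w ((extChartAt (𝓡 n) y).symm z)) (extChartAt (𝓡 n) y).target :=
  (hw.comp_contMDiffOn ((contMDiffOn_extChartAt_symm (n := ∞) y).of_le hk)).contDiffOn

theorem contDiffOn_density_mul (hX : IsC1Field X) (y : M) (i : Fin n) :
    ContDiffOn ℝ 1 (fun z => volDensity g y z * chartField X y z i)
      (extChartAt (𝓡 n) y).target :=
  ((contDiffOn_volDensity g y).of_le (by simp)).mul (contDiffOn_euclidean.1 (hX y) i)

theorem continuousOn_chartDivergence (hX : IsC1Field X) (y : M) :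
    ContinuousOn (chartDivergence g X y) (extChartAt (𝓡 n) y).target := by
  refine ContinuousOn.mul ((contDiffOn_volDensity g y).continuousOn.inv₀
    fun z hz => (volDensity_pos g hz).ne') ?_
  refine continuousOn_finsetSum _ fun i _ => ?_
  exact ((contDiffOn_density_mul hX y i).continuousOn_fderiv_of_isOpen
    (isOpen_extChartAt_target y) (by simp)).clm_apply continuousOn_const

theorem continuousOn_chartDivergence_comp (hX : IsC1Field X) (y : M) :
    ContinuousOn (fun x => chartDivergence g X y (extChartAt (𝓡 n) y x))
      (extChartAt (𝓡 n) y).source :=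
  (continuousOn_chartDivergence hX y).comp (continuousOn_extChartAt y)
    fun _ hx => (extChartAt (𝓡 n) y).map_source hx

theorem continuous_dirDeriv (hX : IsC1Field X) (hφ : ContMDiff (𝓡 n) 𝓘(ℝ) 1 φ) :
    Continuous (dirDeriv φ X) := by
  refine continuous_iff_continuousAt.2 fun y => ?_
  have hsrc := isOpen_extChartAt_source (I := 𝓡 n) y
  refine ContinuousOn.continuousAt ?_ (hsrc.mem_nhds (mem_extChartAt_source y))
  have h : ContinuousOn (fun x => fderiv ℝ (fun z => φ ((extChartAt (𝓡 n) y).symm z))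
      (extChartAt (𝓡 n) y x) (chartField X y (extChartAt (𝓡 n) y x)))
      (extChartAt (𝓡 n) y).source := by
    refine ContinuousOn.comp (t := (extChartAt (𝓡 n) y).target)
      (g := fun z' => fderiv ℝ (fun z => φ ((extChartAt (𝓡 n) y).symm z)) z' (chartField X y z'))
      ?_ (continuousOn_extChartAt y) fun _ hx => (extChartAt (𝓡 n) y).map_source hx
    exact ((contDiffOn_comp_symm (by simp) hφ y).continuousOn_fderiv_of_isOpen
      (isOpen_extChartAt_target y) (by simp)).clm_apply (hX y).continuousOn
  exact h.congr fun x hx => dirDeriv_eq_fderiv hx (hφ.mdifferentiableAt (by simp))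

theorem continuous_mul_of_tsupport_subset {Y : Type*} [TopologicalSpace Y] {φ c : Y → ℝ} {U : Set Y}
    (hU : IsOpen U) (hφ : Continuous φ) (hc : ContinuousOn c U) (hs : tsupport φ ⊆ U) :
    Continuous fun x => φ x * c x := by
  refine continuous_of_tsupport fun x hx => ?_
  have hx' : x ∈ U := hs (tsupport_mul_subset_left hx)
  exact hφ.continuousAt.mul (hc.continuousAt (hU.mem_nhds hx'))

variable [CompactSpace M] [MeasurableSpace M] [BorelSpace M]

/-- The divergence theorem for a test function supported in one chart. -/
theorem integral_mul_chartDivergence (hX : IsC1Field X) (hφ : ContMDiff (𝓡 n) 𝓘(ℝ) 1 φ) {y : M}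
    (hs : tsupport φ ⊆ (extChartAt (𝓡 n) y).source) :
    ∫ x, φ x * chartDivergence g X y (extChartAt (𝓡 n) y x) ∂(riemannianVolume g) =
      -∫ x, dirDeriv φ X x ∂(riemannianVolume g) := by
  set S := (extChartAt (𝓡 n) y).source
  set V := (extChartAt (𝓡 n) y).target
  have hV : IsOpen V := isOpen_extChartAt_target y
  have hφS : ∀ x ∉ S, φ x = 0 := fun x hx => image_eq_zero_of_notMem_tsupport fun h => hx (hs h)
  have hdS : ∀ x ∉ tsupport φ, dirDeriv φ X x = 0 := fun x hx => by
    have : φ =ᶠ[nhds x] fun _ => 0 := by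
      filter_upwards [(isClosed_tsupport φ).isOpen_compl.mem_nhds hx] with w hw
        using image_eq_zero_of_notMem_tsupport hw
    rw [dirDeriv, this.mfderiv_eq, mfderiv_const]
    rfl
  have hq : ContinuousOn (fun x => φ x * chartDivergence g X y (extChartAt (𝓡 n) y x)) S :=
    hφ.continuous.continuousOn.mul (continuousOn_chartDivergence_comp hX y)
  rw [← setIntegral_eq_integral_of_forall_compl_eq_zero (s := S) (fun x hx => by
      rw [hφS x hx, zero_mul]),
    ← setIntegral_eq_integral_of_forall_compl_eq_zero (s := S) (fun x hx => hdS x fun h =>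
      hx (hs h)),
    setIntegral_source_eq g y hq,
    setIntegral_source_eq g y (continuous_dirDeriv hX hφ).continuousOn, ← add_eq_zero_iff_eq_neg]
  set ψ : EuclideanSpace ℝ (Fin n) → ℝ := fun z => φ ((extChartAt (𝓡 n) y).symm z) with hψ
  have hψC : ContDiffOn ℝ 1 ψ V := contDiffOn_comp_symm (by simp) hφ y
  set Y : Fin n → EuclideanSpace ℝ (Fin n) → ℝ :=
    fun i z => volDensity g y z * chartField X y z i with hY
  have hYC : ∀ i, ContDiffOn ℝ 1 (Y i) V := contDiffOn_density_mul hX y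
  set K := extChartAt (𝓡 n) y '' tsupport φ
  have hKc : IsCompact K := (isClosed_tsupport φ).isCompact.image_of_continuousOn
    ((continuousOn_extChartAt y).mono hs)
  have hKV : K ⊆ V := by
    rintro _ ⟨x, hx, rfl⟩
    exact (extChartAt (𝓡 n) y).map_source (hs hx)
  have hnot : ∀ z ∈ V, z ∉ K → (extChartAt (𝓡 n) y).symm z ∉ tsupport φ := fun z hz hzK h =>
    hzK ⟨_, h, (extChartAt (𝓡 n) y).right_inv hz⟩
  have hψ0 : ∀ z ∈ V, z ∉ K → ψ z = 0 := fun z hz hzK =>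
    image_eq_zero_of_notMem_tsupport (f := φ) (hnot z hz hzK)
  have hprod : ∀ z ∈ V, ∀ i, fderiv ℝ (fun z => ψ z * Y i z) z (EuclideanSpace.single i 1) =
      ψ z * fderiv ℝ (Y i) z (EuclideanSpace.single i 1) +
        Y i z * fderiv ℝ ψ z (EuclideanSpace.single i 1) := fun z hz i => by
    rw [fderiv_fun_mul ((hψC.contDiffAt (hV.mem_nhds hz)).differentiableAt (by simp))
      (((hYC i).contDiffAt (hV.mem_nhds hz)).differentiableAt (by simp))]
    simp
  have hcd : ∀ i, ContinuousOn
      (fun z => fderiv ℝ (fun z => ψ z * Y i z) z (EuclideanSpace.single i 1)) V := fun i =>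
    ((hψC.mul (hYC i)).continuousOn_fderiv_of_isOpen hV (by simp)).clm_apply continuousOn_const
  have hpt1 : ∀ z ∈ V, volDensity g y z * (ψ z * chartDivergence g X y
      (extChartAt (𝓡 n) y ((extChartAt (𝓡 n) y).symm z))) =
      ∑ i, ψ z * fderiv ℝ (Y i) z (EuclideanSpace.single i 1) := fun z hz => by
    rw [(extChartAt (𝓡 n) y).right_inv hz, chartDivergence, ← Finset.mul_sum]
    have := (volDensity_pos g hz).ne'
    field_simp
    rfl
  have hpt2 : ∀ z ∈ V, volDensity g y z * dirDeriv φ X ((extChartAt (𝓡 n) y).symm z) =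
      ∑ i, Y i z * fderiv ℝ ψ z (EuclideanSpace.single i 1) := fun z hz => by
    rw [dirDeriv_eq_fderiv (y := y) ((extChartAt (𝓡 n) y).map_target hz)
      (hφ.mdifferentiableAt (by simp)), (extChartAt (𝓡 n) y).right_inv hz, fderiv_apply_eq_sum,
      Finset.mul_sum]
    exact Finset.sum_congr rfl fun i _ => by rw [hY, mul_assoc]
  have hintOn : ∀ q : EuclideanSpace ℝ (Fin n) → ℝ, ContinuousOn q V →
      (∀ z ∈ V, z ∉ K → q z = 0) → IntegrableOn q V := fun q hq hq0 => by
    refine ((hq.mono hKV).integrableOn_compact hKc).of_forall_sdiff_eq_zero hV.measurableSet ?_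
    exact fun z hz => hq0 z hz.1 hz.2
  have hψ0' : ∀ z ∈ V, z ∉ K → fderiv ℝ ψ z = 0 := fun z hz hzK => by
    have : ψ =ᶠ[nhds z] fun _ => 0 := by
      filter_upwards [hV.mem_nhds hz, hKc.isClosed.isOpen_compl.mem_nhds hzK] with w hw hwK
        using hψ0 w hw hwK
    rw [this.fderiv_eq]
    simp
  have hi1 : ∀ i, IntegrableOn (fun z => ψ z * fderiv ℝ (Y i) z (EuclideanSpace.single i 1)) V :=
    fun i => hintOn _ (hψC.continuousOn.mul (((hYC i).continuousOn_fderiv_of_isOpen hV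
      (by simp)).clm_apply continuousOn_const)) fun z hz hzK => by rw [hψ0 z hz hzK, zero_mul]
  have hi2 : ∀ i, IntegrableOn (fun z => Y i z * fderiv ℝ ψ z (EuclideanSpace.single i 1)) V :=
    fun i => hintOn _ ((hYC i).continuousOn.mul ((hψC.continuousOn_fderiv_of_isOpen hV
      (by simp)).clm_apply continuousOn_const)) fun z hz hzK => by simp [hψ0' z hz hzK]
  -- The two integrands add up to `∂_i(ψ Y_i)`, which has compact support in `V`. The density inside
  -- `Y_i` cancels the factor `1/√det g` of the divergence.
  have hzero : ∀ i, (∫ z in V, ψ z * fderiv ℝ (Y i) z (EuclideanSpace.single i 1)) +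
      ∫ z in V, Y i z * fderiv ℝ ψ z (EuclideanSpace.single i 1) = 0 := fun i => by
    rw [← integral_add (hi1 i) (hi2 i), ← setIntegral_fderiv_eq_zero (μ := volume) hV hKc hKV
      (hψC.mul (hYC i)) (fun z hz hzK => by rw [hψ0 z hz hzK, zero_mul])
      (EuclideanSpace.single i 1)]
    exact setIntegral_congr_fun hV.measurableSet fun z hz => (hprod z hz i).symm
  rw [setIntegral_congr_fun hV.measurableSet hpt1, setIntegral_congr_fun hV.measurableSet hpt2,
    integral_finsetSum _ fun i _ => hi1 i, integral_finsetSum _ fun i _ => hi2 i,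
    ← Finset.sum_add_distrib]
  exact Finset.sum_eq_zero fun i _ => hzero i

variable [T2Space M]

/-- The divergence does not depend on the chart. -/
theorem chartDivergence_congr (hX : IsC1Field X) {y y' p : M}
    (hp : p ∈ (extChartAt (𝓡 n) y).source) (hp' : p ∈ (extChartAt (𝓡 n) y').source) :
    chartDivergence g X y (extChartAt (𝓡 n) y p) =
      chartDivergence g X y' (extChartAt (𝓡 n) y' p) := by
  set U := (extChartAt (𝓡 n) y).source ∩ (extChartAt (𝓡 n) y').source
  have hU : IsOpen U := (isOpen_extChartAt_source y).inter (isOpen_extChartAt_source y')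
  have hc : ContinuousOn (fun x => chartDivergence g X y (extChartAt (𝓡 n) y x)) U :=
    (continuousOn_chartDivergence_comp hX y).mono inter_subset_left
  have hc' : ContinuousOn (fun x => chartDivergence g X y' (extChartAt (𝓡 n) y' x)) U :=
    (continuousOn_chartDivergence_comp hX y').mono inter_subset_right
  have : SecondCountableTopology M :=
    ChartedSpace.secondCountable_of_sigmaCompact (EuclideanSpace ℝ (Fin n)) M
  -- Both chart expressions have the same integral against every test function supported in the
  -- overlap, namely `-∫ dφ(X)`, which mentions no chart. They agree almost everywhere, hence
  -- everywhere by continuity; no transformation law is computed.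
  have hae := IsOpen.ae_eq_zero_of_integral_contMDiff_smul_eq_zero (𝓡 n)
    (μ := riemannianVolume g) hU
    ((hc.sub hc').locallyIntegrableOn hU.measurableSet) fun φ hφ _ hs => by
      have hφ1 : ContMDiff (𝓡 n) 𝓘(ℝ) 1 φ := hφ.of_le (by simp)
      have i1 : Integrable (fun x => φ x * chartDivergence g X y (extChartAt (𝓡 n) y x))
          (riemannianVolume g) :=
        (continuous_mul_of_tsupport_subset hU hφ.continuous hc hs).integrable_of_hasCompactSupport
          (HasCompactSupport.of_compactSpace _)
      have i2 : Integrable (fun x => φ x * chartDivergence g X y' (extChartAt (𝓡 n) y' x))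
          (riemannianVolume g) :=
        (continuous_mul_of_tsupport_subset hU hφ.continuous hc' hs).integrable_of_hasCompactSupport
          (HasCompactSupport.of_compactSpace _)
      simp only [smul_eq_mul, Pi.sub_apply, mul_sub]
      rw [integral_sub i1 i2,
        integral_mul_chartDivergence hX hφ1 (hs.trans inter_subset_left),
        integral_mul_chartDivergence hX hφ1 (hs.trans inter_subset_right), sub_self]
  rw [← ae_restrict_iff' hU.measurableSet] at hae
  refine Measure.eqOn_open_of_ae_eq (μ := riemannianVolume g) (U := U) ?_ hU hc hc' ⟨hp, hp'⟩
  filter_upwards [hae] with x hx using sub_eq_zero.1 hx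

theorem divergence_eq (hX : IsC1Field X) {y x : M} (hx : x ∈ (extChartAt (𝓡 n) y).source) :
    divergence g X x = chartDivergence g X y (extChartAt (𝓡 n) y x) :=
  chartDivergence_congr hX (mem_extChartAt_source x) hx

/-- `divergence` uses a different chart at each point, so continuity requires passing to one fixed
chart nearby. -/
theorem continuous_divergence (hX : IsC1Field X) : Continuous (divergence g X) := by
  refine continuous_iff_continuousAt.2 fun y => ?_
  refine ContinuousOn.continuousAt ?_
    ((isOpen_extChartAt_source y).mem_nhds (mem_extChartAt_source (I := 𝓡 n) y))
  exact (continuousOn_chartDivergence_comp hX y).congr fun x hx => divergence_eq hX hx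

/-- The divergence theorem on a closed manifold. -/
theorem integral_mul_divergence (hX : IsC1Field X) (hφ : ContMDiff (𝓡 n) 𝓘(ℝ) 1 φ) :
    ∫ x, φ x * divergence g X x ∂(riemannianVolume g) =
      -∫ x, dirDeriv φ X x ∂(riemannianVolume g) := by
  obtain ⟨t, ht⟩ := CompactSpace.elim_nhds_subcover
    (fun y : M => (extChartAt (𝓡 n) y).source) fun y => extChartAt_source_mem_nhds y
  -- The partition is indexed by a finite subcover, so all sums below are finite and commute with
  -- integrals and derivatives.
  obtain ⟨ρ, hρ⟩ := SmoothPartitionOfUnity.exists_isSubordinate (𝓡 n) (isClosed_univ (X := M))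
    (fun y : t => (extChartAt (𝓡 n) (y : M)).source) (fun y => isOpen_extChartAt_source _)
    (by
      intro x _
      have hx : x ∈ ⋃ y ∈ t, (extChartAt (𝓡 n) y).source := ht ▸ mem_univ x
      simpa using hx)
  have hρ1 : ∀ x, ∑ i, ρ i x = 1 := fun x => by
    rw [← finsum_eq_sum_of_fintype]
    exact ρ.sum_eq_one (mem_univ x)
  have hψ : ∀ i, ContMDiff (𝓡 n) 𝓘(ℝ) 1 (fun x => ρ i x * φ x) := fun i =>
    ((ρ i).contMDiff.of_le (by simp)).mul hφ
  have hsub : ∀ i : t, tsupport (fun x => ρ i x * φ x) ⊆ (extChartAt (𝓡 n) (i : M)).source :=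
    fun i => (tsupport_mul_subset_left).trans (hρ i)
  have hφsum : φ = fun x => ∑ i, ρ i x * φ x := by
    ext x
    rw [← Finset.sum_mul, hρ1, one_mul]
  have hd : ∀ x, dirDeriv φ X x = ∑ i, dirDeriv (fun x => ρ i x * φ x) X x := fun x => by
    have hdiff : ∀ i, DifferentiableAt ℝ (fun z => ρ i ((extChartAt (𝓡 n) x).symm z) *
        φ ((extChartAt (𝓡 n) x).symm z)) (extChartAt (𝓡 n) x x) := fun i =>
      ((contDiffOn_comp_symm (by simp) (hψ i) x).contDiffAt
        ((isOpen_extChartAt_target x).mem_nhds (mem_extChartAt_target x))).differentiableAt (by simp)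
    rw [dirDeriv_eq_fderiv (mem_extChartAt_source x) (hφ.mdifferentiableAt (by simp))]
    conv_lhs => rw [hφsum]
    simp only [dirDeriv_eq_fderiv (mem_extChartAt_source x) ((hψ _).mdifferentiableAt (by simp))]
    rw [fderiv_fun_sum fun i _ => hdiff i]
    simp only [sum_apply]
  have hi : ∀ {q : M → ℝ}, Continuous q → Integrable q (riemannianVolume g) := fun hq =>
    hq.integrable_of_hasCompactSupport (HasCompactSupport.of_compactSpace _)
  calc ∫ x, φ x * divergence g X x ∂(riemannianVolume g)
      = ∫ x, ∑ i, ρ i x * φ x * divergence g X x ∂(riemannianVolume g) := by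
        refine integral_congr_ae (Filter.Eventually.of_forall fun x => ?_)
        simp only [← Finset.sum_mul, hρ1, one_mul]
    _ = ∑ i, ∫ x, ρ i x * φ x * divergence g X x ∂(riemannianVolume g) :=
        integral_finsetSum _ fun i _ => hi ((hψ i).continuous.mul (continuous_divergence hX))
    _ = ∑ i, -∫ x, dirDeriv (fun x => ρ i x * φ x) X x ∂(riemannianVolume g) := by
        refine Finset.sum_congr rfl fun i _ => ?_
        rw [← integral_mul_chartDivergence hX (hψ i) (hsub i)]
        refine integral_congr_ae (Filter.Eventually.of_forall fun x => ?_)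
        by_cases hx : x ∈ (extChartAt (𝓡 n) (i : M)).source
        · simp only [divergence_eq hX hx]
        · have : ρ i x * φ x = 0 := image_eq_zero_of_notMem_tsupport
            (f := fun x => ρ i x * φ x) fun h => hx (hsub i h)
          simp only [this, zero_mul]
    _ = -∫ x, dirDeriv φ X x ∂(riemannianVolume g) := by
        rw [Finset.sum_neg_distrib, ← integral_finsetSum _ fun i _ =>
          hi (continuous_dirDeriv hX (hψ i))]
        simp only [hd]

end Divergence

/-! ### The weighted measure and integration by parts for the diffusion operator -/

section Diffusion

variable {n N : ℕ} {M : Type*} [TopologicalSpace M] [ChartedSpace (EuclideanSpace ℝ (Fin n)) M]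
  [IsManifold (𝓡 n) ∞ M] {g : SmoothMetric n M} {f : M → ℝ}
  {T : (x : M) → TangentSpace (𝓡 n) x →L[ℝ] TangentSpace (𝓡 n) x}

section Measure

variable [MeasurableSpace M] [BorelSpace M]

theorem aemeasurable_weight (hf : Continuous f) (μ : Measure M) :
    AEMeasurable (fun x => ENNReal.ofReal (Real.exp (-f x))) μ :=
  (Real.continuous_exp.comp hf.neg).measurable.ennreal_ofReal.aemeasurable

theorem isLocallyFiniteMeasure_weightedVolume (g : SmoothMetric n M) (hf : Continuous f) :
    IsLocallyFiniteMeasure (weightedVolume g f) :=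
  IsLocallyFiniteMeasure.withDensity_ofReal (Real.continuous_exp.comp hf.neg)

theorem isOpenPosMeasure_weightedVolume (g : SmoothMetric n M) (hf : Continuous f) :
    (weightedVolume g f).IsOpenPosMeasure :=
  (withDensity_absolutelyContinuous' (aemeasurable_weight hf (riemannianVolume g))
    (Filter.Eventually.of_forall fun x => by simp [Real.exp_pos])).isOpenPosMeasure

theorem integral_weightedVolume (g : SmoothMetric n M) (hf : Continuous f) (q : M → ℝ) :
    ∫ x, q x ∂(weightedVolume g f) = ∫ x, Real.exp (-f x) * q x ∂(riemannianVolume g) := by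
  rw [weightedVolume, integral_withDensity_eq_integral_toReal_smul₀
    (aemeasurable_weight hf _) (by simp)]
  simp only [ENNReal.toReal_ofReal (Real.exp_pos _).le, smul_eq_mul]

theorem integrable_weightedVolume [CompactSpace M] (g : SmoothMetric n M) (hf : Continuous f)
    {q : M → ℝ} (hq : Continuous q) : Integrable q (weightedVolume g f) := by
  have := isLocallyFiniteMeasure_weightedVolume g hf
  exact hq.integrable_of_hasCompactSupport (HasCompactSupport.of_compactSpace _)

end Measure

/-- The vector field `T ∇w`. -/
def fluxField (g : SmoothMetric n M)
    (T : (x : M) → TangentSpace (𝓡 n) x →L[ℝ] TangentSpace (𝓡 n) x) (w : M → ℝ) (x : M) :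
    TangentSpace (𝓡 n) x := T x (grad g w x)

theorem isC1Field_fluxField (hT : IsSymmPosTensor g T) {w : M → ℝ}
    (hw : ContMDiff (𝓡 n) 𝓘(ℝ) ∞ w) : IsC1Field (fluxField g T w) := fun y => by
  have h := ((contDiffOn_chartFlux g hT y).clm_apply
    ((contDiffOn_comp_symm le_rfl hw y).fderiv_of_isOpen (m := ∞)
      (isOpen_extChartAt_target y) (by simp))).of_le (m := 1) (by simp)
  exact h.congr fun z hz => chartField_flux g T hz (hw.mdifferentiableAt (by simp))

theorem inner_grad_fluxField (v w : M → ℝ) (x : M) :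
    g.inner x (grad g v x) (T x (grad g w x)) = dirDeriv v (fluxField g T w) x :=
  inner_grad g v x _

theorem dirDeriv_fluxField_symm (hT : IsSymmPosTensor g T) (v w : M → ℝ) (x : M) :
    dirDeriv v (fluxField g T w) x = dirDeriv w (fluxField g T v) x := by
  rw [← inner_grad_fluxField, ← inner_grad_fluxField, g.symm, hT.symm]

theorem diffusion_eq (f w : M → ℝ) (x : M) :
    diffusion g f T w x =
      divergence g (fluxField g T w) x - dirDeriv f (fluxField g T w) x := by
  rw [← inner_grad_fluxField]
  rfl

theorem gradEnergy_eq (w : M → EuclideanSpace ℝ (Fin N)) (x : M) :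
    gradEnergy g T w x =
      ∑ k, dirDeriv (fun y => w y k) (fluxField g T fun y => w y k) x := by
  refine Finset.sum_congr rfl fun k _ => ?_
  rw [g.symm, inner_grad_fluxField]

theorem gradEnergy_nonneg (hT : IsSymmPosTensor g T) (w : M → EuclideanSpace ℝ (Fin N)) (x : M) :
    0 ≤ gradEnergy g T w x := by
  refine Finset.sum_nonneg fun k _ => ?_
  by_cases h : grad g (fun y => w y k) x = 0
  · simp [h]
  · exact (hT.pos x _ h).le

theorem dirDeriv_exp_neg_mul {v : M → ℝ} {x : M} (X : (x : M) → TangentSpace (𝓡 n) x)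
    (hf : ContMDiff (𝓡 n) 𝓘(ℝ) 1 f) (hv : ContMDiff (𝓡 n) 𝓘(ℝ) 1 v) :
    dirDeriv (fun x => Real.exp (-f x) * v x) X x =
      Real.exp (-f x) * (dirDeriv v X x - v x * dirDeriv f X x) := by
  have hs := mem_extChartAt_source (I := 𝓡 n) x
  have hexp : ContMDiff (𝓡 n) 𝓘(ℝ) 1 fun x => Real.exp (-f x) :=
    (Real.contDiff_exp.comp contDiff_neg).contMDiff.comp hf
  have hd : ∀ {w : M → ℝ}, ContMDiff (𝓡 n) 𝓘(ℝ) 1 w → DifferentiableAt ℝ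
      (fun z => w ((extChartAt (𝓡 n) x).symm z)) (extChartAt (𝓡 n) x x) := fun hw =>
    ((contDiffOn_comp_symm (by simp) hw x).contDiffAt
      ((isOpen_extChartAt_target x).mem_nhds (mem_extChartAt_target x))).differentiableAt (by simp)
  have hder : HasFDerivAt (fun z => Real.exp (-f ((extChartAt (𝓡 n) x).symm z)) *
      v ((extChartAt (𝓡 n) x).symm z)) _ _ :=
    (hd hf).hasFDerivAt.neg.exp.mul (hd hv).hasFDerivAt
  have hprod : ContMDiff (𝓡 n) 𝓘(ℝ) 1 fun x => Real.exp (-f x) * v x := hexp.mul hv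
  rw [dirDeriv_eq_fderiv hs (hprod.mdifferentiableAt (by simp)),
    dirDeriv_eq_fderiv hs (hv.mdifferentiableAt (by simp)),
    dirDeriv_eq_fderiv hs (hf.mdifferentiableAt (by simp)),
    hder.fderiv]
  simp only [extChartAt_to_inv, add_apply, smul_apply, neg_apply, Pi.neg_apply, smul_eq_mul]
  ring

theorem contMDiff_component {k : WithTop ℕ∞} {w : M → EuclideanSpace ℝ (Fin N)}
    (hw : ContMDiff (𝓡 n) 𝓘(ℝ, EuclideanSpace ℝ (Fin N)) k w) (i : Fin N) :
    ContMDiff (𝓡 n) 𝓘(ℝ) k fun x => w x i :=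
  (EuclideanSpace.proj (𝕜 := ℝ) i).contDiff.contMDiff.comp hw

theorem inner_vecDiffusion (v : EuclideanSpace ℝ (Fin N)) (w : M → EuclideanSpace ℝ (Fin N))
    (x : M) : inner ℝ v (vecDiffusion g f T w x) =
      ∑ k, v k * diffusion g f T (fun y => w y k) x := by
  rw [PiLp.inner_apply]
  exact Finset.sum_congr rfl fun k _ => by simp [vecDiffusion, mul_comm]

variable [CompactSpace M] [T2Space M] [MeasurableSpace M] [BorelSpace M]

theorem continuous_diffusion (hf : ContMDiff (𝓡 n) 𝓘(ℝ) 1 f) (hT : IsSymmPosTensor g T)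
    {w : M → ℝ} (hw : ContMDiff (𝓡 n) 𝓘(ℝ) ∞ w) : Continuous (diffusion g f T w) := by
  have hX := isC1Field_fluxField hT hw
  exact ((continuous_divergence hX).sub (continuous_dirDeriv hX hf)).congr
    fun x => (diffusion_eq f w x).symm

/-- The divergence theorem with test function `e^{-f} v`: differentiating the weight produces
exactly the drift term of `𝓛`. -/
theorem integral_mul_diffusion (hf : ContMDiff (𝓡 n) 𝓘(ℝ) 1 f) (hT : IsSymmPosTensor g T)
    {v w : M → ℝ} (hv : ContMDiff (𝓡 n) 𝓘(ℝ) ∞ v) (hw : ContMDiff (𝓡 n) 𝓘(ℝ) ∞ w) :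
    ∫ x, v x * diffusion g f T w x ∂(weightedVolume g f) =
      -∫ x, dirDeriv v (fluxField g T w) x ∂(weightedVolume g f) := by
  have hX := isC1Field_fluxField hT hw
  have hv1 : ContMDiff (𝓡 n) 𝓘(ℝ) 1 v := hv.of_le (by simp)
  have hexp : ContMDiff (𝓡 n) 𝓘(ℝ) 1 fun x => Real.exp (-f x) :=
    (Real.contDiff_exp.comp contDiff_neg).contMDiff.comp hf
  have hi : ∀ {q : M → ℝ}, Continuous q → Integrable q (riemannianVolume g) := fun hq =>
    hq.integrable_of_hasCompactSupport (HasCompactSupport.of_compactSpace _)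
  have hdf := continuous_dirDeriv hX hf
  have hdv := continuous_dirDeriv hX hv1
  have key := integral_mul_divergence (g := g) hX (hexp.mul hv1)
  simp only [Pi.mul_apply] at key
  have hprod : ∀ x, dirDeriv ((fun x => Real.exp (-f x)) * v) (fluxField g T w) x = _ :=
    fun x => dirDeriv_exp_neg_mul (fluxField g T w) hf hv1
  simp only [hprod] at key
  rw [integral_weightedVolume g hf.continuous, integral_weightedVolume g hf.continuous]
  have e1 : ∀ x, Real.exp (-f x) * (v x * diffusion g f T w x) =
      Real.exp (-f x) * v x * divergence g (fluxField g T w) x -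
        Real.exp (-f x) * (v x * dirDeriv f (fluxField g T w) x) := fun x => by
    rw [diffusion_eq]; ring
  have i1 : Integrable (fun x => Real.exp (-f x) * v x * divergence g (fluxField g T w) x)
      (riemannianVolume g) :=
    hi ((hexp.continuous.mul hv.continuous).mul (continuous_divergence hX))
  have i2 : Integrable (fun x => Real.exp (-f x) * (v x * dirDeriv f (fluxField g T w) x))
      (riemannianVolume g) := hi (hexp.continuous.mul (hv.continuous.mul hdf))
  have i3 : Integrable (fun x => Real.exp (-f x) * dirDeriv v (fluxField g T w) x)
      (riemannianVolume g) := hi (hexp.continuous.mul hdv)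
  simp only [e1]
  rw [integral_sub i1 i2, key]
  simp only [mul_sub]
  rw [integral_sub i3 i2]
  ring

theorem continuous_vecDiffusion (hf : ContMDiff (𝓡 n) 𝓘(ℝ) 1 f) (hT : IsSymmPosTensor g T)
    {w : M → EuclideanSpace ℝ (Fin N)}
    (hw : ContMDiff (𝓡 n) 𝓘(ℝ, EuclideanSpace ℝ (Fin N)) ∞ w) :
    Continuous (vecDiffusion g f T w) :=
  (PiLp.continuous_toLp 2 _).comp
    (continuous_pi fun k => continuous_diffusion hf hT (contMDiff_component hw k))

theorem continuous_gradEnergy (hT : IsSymmPosTensor g T) {w : M → EuclideanSpace ℝ (Fin N)}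
    (hw : ContMDiff (𝓡 n) 𝓘(ℝ, EuclideanSpace ℝ (Fin N)) ∞ w) :
    Continuous (gradEnergy g T w) := by
  refine Continuous.congr ?_ fun x => (gradEnergy_eq w x).symm
  exact continuous_finsetSum _ fun k _ =>
    continuous_dirDeriv (isC1Field_fluxField hT (contMDiff_component hw k))
      ((contMDiff_component hw k).of_le (by simp))

theorem integral_inner_vecDiffusion (hf : ContMDiff (𝓡 n) 𝓘(ℝ) 1 f) (hT : IsSymmPosTensor g T)
    {v w : M → EuclideanSpace ℝ (Fin N)}
    (hv : ContMDiff (𝓡 n) 𝓘(ℝ, EuclideanSpace ℝ (Fin N)) ∞ v)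
    (hw : ContMDiff (𝓡 n) 𝓘(ℝ, EuclideanSpace ℝ (Fin N)) ∞ w) :
    ∫ x, inner ℝ (v x) (vecDiffusion g f T w x) ∂(weightedVolume g f) =
      -∑ k, ∫ x, dirDeriv (fun y => v y k) (fluxField g T fun y => w y k) x
        ∂(weightedVolume g f) := by
  simp only [inner_vecDiffusion]
  have hi : ∀ k, Integrable (fun x => v x k * diffusion g f T (fun y => w y k) x)
      (weightedVolume g f) := fun k => integrable_weightedVolume g hf.continuous
    ((contMDiff_component hv k).continuous.mul
      (continuous_diffusion hf hT (contMDiff_component hw k)))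
  rw [integral_finsetSum _ fun k _ => hi k, ← Finset.sum_neg_distrib]
  exact Finset.sum_congr rfl fun k _ =>
    integral_mul_diffusion hf hT (contMDiff_component hv k) (contMDiff_component hw k)

/-- The operator `𝓛` is symmetric with respect to the weighted measure. -/
theorem integral_inner_vecDiffusion_comm (hf : ContMDiff (𝓡 n) 𝓘(ℝ) 1 f)
    (hT : IsSymmPosTensor g T) {v w : M → EuclideanSpace ℝ (Fin N)}
    (hv : ContMDiff (𝓡 n) 𝓘(ℝ, EuclideanSpace ℝ (Fin N)) ∞ v)
    (hw : ContMDiff (𝓡 n) 𝓘(ℝ, EuclideanSpace ℝ (Fin N)) ∞ w) :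
    ∫ x, inner ℝ (v x) (vecDiffusion g f T w x) ∂(weightedVolume g f) =
      ∫ x, inner ℝ (w x) (vecDiffusion g f T v x) ∂(weightedVolume g f) := by
  rw [integral_inner_vecDiffusion hf hT hv hw, integral_inner_vecDiffusion hf hT hw hv]
  simp only [dirDeriv_fluxField_symm hT]

theorem integral_inner_vecDiffusion_self (hf : ContMDiff (𝓡 n) 𝓘(ℝ) 1 f)
    (hT : IsSymmPosTensor g T) {w : M → EuclideanSpace ℝ (Fin N)}
    (hw : ContMDiff (𝓡 n) 𝓘(ℝ, EuclideanSpace ℝ (Fin N)) ∞ w) :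
    ∫ x, inner ℝ (w x) (vecDiffusion g f T w x) ∂(weightedVolume g f) =
      -∫ x, gradEnergy g T w x ∂(weightedVolume g f) := by
  rw [integral_inner_vecDiffusion hf hT hw hw]
  simp only [gradEnergy_eq]
  rw [integral_finsetSum _ fun k _ => integrable_weightedVolume g hf.continuous
    (continuous_dirDeriv (isC1Field_fluxField hT (contMDiff_component hw k))
      ((contMDiff_component hw k).of_le (by simp)))]

end Diffusion

/-! ### Joint regularity in space and time -/

section Slices

variable {E G : Type*} [NormedAddCommGroup E] [NormedSpace ℝ E] [NormedAddCommGroup G]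
  [NormedSpace ℝ G] {V : Set E} {J : Set ℝ} {F : E × ℝ → G}

theorem hasFDerivAt_space_slice (hV : IsOpen V) (hF : ContDiffOn ℝ ∞ F (V ×ˢ J)) {z : E} {t : ℝ}
    (hz : z ∈ V) (ht : t ∈ J) :
    HasFDerivAt (fun z => F (z, t))
      ((fderivWithin ℝ F (V ×ˢ J) (z, t)).comp (ContinuousLinearMap.inl ℝ E ℝ)) z := by
  have h1 := (hF.differentiableOn (by simp) (z, t) ⟨hz, ht⟩).hasFDerivWithinAt
  have h2 : HasFDerivWithinAt (fun z : E => (z, t)) (ContinuousLinearMap.inl ℝ E ℝ) V z :=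
    (hasFDerivAt_prodMk_left z t).hasFDerivWithinAt
  have hm : MapsTo (fun z : E => (z, t)) V (V ×ˢ J) := fun w hw => ⟨hw, ht⟩
  exact (h1.comp z h2 hm).hasFDerivAt (hV.mem_nhds hz)

theorem hasDerivWithinAt_time_slice (hF : ContDiffOn ℝ ∞ F (V ×ˢ J)) {z : E} {t : ℝ}
    (hz : z ∈ V) (ht : t ∈ J) :
    HasDerivWithinAt (fun s => F (z, s)) (fderivWithin ℝ F (V ×ˢ J) (z, t) (0, 1)) J t := by
  have h1 := (hF.differentiableOn (by simp) (z, t) ⟨hz, ht⟩).hasFDerivWithinAt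
  have h2 : HasFDerivWithinAt (fun s : ℝ => (z, s)) (ContinuousLinearMap.inr ℝ E ℝ) J t :=
    (hasFDerivAt_prodMk_right z t).hasFDerivWithinAt
  have hm : MapsTo (fun s : ℝ => (z, s)) J (V ×ˢ J) := fun s hs => ⟨hz, hs⟩
  have h := (h1.comp t h2 hm).hasDerivWithinAt
  rwa [ContinuousLinearMap.comp_apply, ContinuousLinearMap.inr_apply] at h

theorem contDiffOn_fderivWithin_prod (hV : IsOpen V) (hJ : UniqueDiffOn ℝ J)
    (hF : ContDiffOn ℝ ∞ F (V ×ˢ J)) :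
    ContDiffOn ℝ ∞ (fderivWithin ℝ F (V ×ˢ J)) (V ×ˢ J) :=
  hF.fderivWithin (hV.uniqueDiffOn.prod hJ) (by simp)

/-- `J` is not assumed open, so the joint derivative is taken within `V ×ˢ J`. Its restriction to
spatial directions is still a full derivative, because `V` is open. -/
theorem contDiffOn_space_fderiv (hV : IsOpen V) (hJ : UniqueDiffOn ℝ J)
    (hF : ContDiffOn ℝ ∞ F (V ×ˢ J)) :
    ContDiffOn ℝ ∞ (fun q : E × ℝ => fderiv ℝ (fun z => F (z, q.2)) q.1) (V ×ˢ J) := by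
  have h := (contDiffOn_fderivWithin_prod hV hJ hF).clm_comp
    (contDiffOn_const (c := ContinuousLinearMap.inl ℝ E ℝ))
  exact h.congr fun q hq => (hasFDerivAt_space_slice hV hF hq.1 hq.2).fderiv

theorem contDiffOn_time_derivWithin (hV : IsOpen V) (hJ : UniqueDiffOn ℝ J)
    (hF : ContDiffOn ℝ ∞ F (V ×ˢ J)) :
    ContDiffOn ℝ ∞ (fun q : E × ℝ => derivWithin (fun s => F (q.1, s)) J q.2) (V ×ˢ J) := by
  have h := (contDiffOn_fderivWithin_prod hV hJ hF).clm_apply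
    (contDiffOn_const (c := ((0 : E), (1 : ℝ))))
  exact h.congr fun q hq =>
    (hasDerivWithinAt_time_slice hF hq.1 hq.2).derivWithin (hJ q.2 hq.2)

end Slices

section SpaceTime

variable {n N : ℕ} {M : Type*} [TopologicalSpace M] [ChartedSpace (EuclideanSpace ℝ (Fin n)) M]
  {J : Set ℝ} {G : Type*} [NormedAddCommGroup G] [NormedSpace ℝ G]

theorem continuousOn_of_source_prod {Y : Type*} [TopologicalSpace Y] {h : M × ℝ → Y}
    (hc : ∀ y : M, ContinuousOn h ((extChartAt (𝓡 n) y).source ×ˢ J)) :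
    ContinuousOn h (univ ×ˢ J) := by
  rintro ⟨x, t⟩ ⟨-, ht⟩
  refine (hc x (x, t) ⟨mem_extChartAt_source x, ht⟩).mono_of_mem_nhdsWithin ?_
  rw [nhdsWithin_prod_eq, nhdsWithin_univ]
  exact Filter.prod_mem_prod (extChartAt_source_mem_nhds x) self_mem_nhdsWithin

theorem continuousOn_comp_chart {Y : Type*} [TopologicalSpace Y] {y : M}
    {h : EuclideanSpace ℝ (Fin n) × ℝ → Y}
    (hh : ContinuousOn h ((extChartAt (𝓡 n) y).target ×ˢ J)) :
    ContinuousOn (fun p : M × ℝ => h (extChartAt (𝓡 n) y p.1, p.2))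
      ((extChartAt (𝓡 n) y).source ×ˢ J) := by
  refine hh.comp (f := fun p : M × ℝ => (extChartAt (𝓡 n) y p.1, p.2)) ?_
    fun p hp => ⟨(extChartAt (𝓡 n) y).map_source hp.1, hp.2⟩
  exact ((continuousOn_extChartAt y).comp continuousOn_fst fun p hp => hp.1).prodMk
    continuousOn_snd

variable [IsManifold (𝓡 n) ∞ M]

theorem contDiffOn_chart_time {u : M → ℝ → G}
    (hu : ContMDiffOn ((𝓡 n).prod 𝓘(ℝ)) 𝓘(ℝ, G) ∞ (fun p : M × ℝ => u p.1 p.2) (univ ×ˢ J))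
    (y : M) :
    ContDiffOn ℝ ∞ (fun q : EuclideanSpace ℝ (Fin n) × ℝ => u ((extChartAt (𝓡 n) y).symm q.1) q.2)
      ((extChartAt (𝓡 n) y).target ×ˢ J) := by
  have h1 : ContMDiffOn ((𝓡 n).prod 𝓘(ℝ)) ((𝓡 n).prod 𝓘(ℝ)) ∞
      (fun q : EuclideanSpace ℝ (Fin n) × ℝ => ((extChartAt (𝓡 n) y).symm q.1, q.2))
      ((extChartAt (𝓡 n) y).target ×ˢ J) :=
    ((contMDiffOn_extChartAt_symm y).comp contMDiffOn_fst fun q hq => hq.1).prodMk contMDiffOn_snd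
  have h2 := hu.comp h1 fun q hq => ⟨mem_univ _, hq.2⟩
  -- The product model on `ℝⁿ × ℝ` becomes the vector space's own model, so that smoothness is again
  -- `ContDiffOn`.
  rw [← modelWithCornersSelf_prod, chartedSpaceSelf_prod] at h2
  exact h2.contDiffOn

theorem contMDiff_slice {u : M → ℝ → G}
    (hu : ContMDiffOn ((𝓡 n).prod 𝓘(ℝ)) 𝓘(ℝ, G) ∞ (fun p : M × ℝ => u p.1 p.2) (univ ×ˢ J))
    {t : ℝ} (ht : t ∈ J) : ContMDiff (𝓡 n) 𝓘(ℝ, G) ∞ fun x => u x t := by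
  rw [← contMDiffOn_univ]
  exact hu.comp (contMDiff_id.prodMk contMDiff_const).contMDiffOn fun x _ => ⟨mem_univ _, ht⟩

theorem hasDerivWithinAt_time {u : M → ℝ → G}
    (hu : ContMDiffOn ((𝓡 n).prod 𝓘(ℝ)) 𝓘(ℝ, G) ∞ (fun p : M × ℝ => u p.1 p.2) (univ ×ˢ J))
    (x : M) {t : ℝ} (ht : t ∈ J) :
    HasDerivWithinAt (u x) (derivWithin (u x) J t) J t := by
  have h := hasDerivWithinAt_time_slice (contDiffOn_chart_time hu x) (mem_extChartAt_target x) ht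
  simp only [extChartAt_to_inv] at h
  exact h.differentiableWithinAt.hasDerivWithinAt

theorem continuousOn_derivWithin_time (hJ : UniqueDiffOn ℝ J) {u : M → ℝ → G}
    (hu : ContMDiffOn ((𝓡 n).prod 𝓘(ℝ)) 𝓘(ℝ, G) ∞ (fun p : M × ℝ => u p.1 p.2) (univ ×ˢ J)) :
    ContinuousOn (fun p : M × ℝ => derivWithin (u p.1) J p.2) (univ ×ˢ J) := by
  refine continuousOn_of_source_prod (n := n) fun y => ?_
  refine (continuousOn_comp_chart (contDiffOn_time_derivWithin (isOpen_extChartAt_target y) hJ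
    (contDiffOn_chart_time hu y)).continuousOn).congr fun p hp => ?_
  simp only [(extChartAt (𝓡 n) y).left_inv hp.1]

variable {g : SmoothMetric n M} {f : M → ℝ}
  {T : (x : M) → TangentSpace (𝓡 n) x →L[ℝ] TangentSpace (𝓡 n) x}
  [CompactSpace M] [T2Space M] [MeasurableSpace M] [BorelSpace M]

/-- Chart independence of the divergence lets `𝓛u` be written near `y` in the one chart at `y`,
where all ingredients are jointly continuous. -/
theorem continuousOn_diffusion_time (hJ : UniqueDiffOn ℝ J) (hf : ContMDiff (𝓡 n) 𝓘(ℝ) 1 f)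
    (hT : IsSymmPosTensor g T) {u : M → ℝ → ℝ}
    (hu : ContMDiffOn ((𝓡 n).prod 𝓘(ℝ)) 𝓘(ℝ) ∞ (fun p : M × ℝ => u p.1 p.2) (univ ×ˢ J)) :
    ContinuousOn (fun p : M × ℝ => diffusion g f T (fun y => u y p.2) p.1) (univ ×ˢ J) := by
  refine continuousOn_of_source_prod (n := n) fun y => ?_
  set V := (extChartAt (𝓡 n) y).target
  have hV : IsOpen V := isOpen_extChartAt_target y
  have hfst : MapsTo (Prod.fst : EuclideanSpace ℝ (Fin n) × ℝ → _) (V ×ˢ J) V := fun q hq => hq.1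
  set flux : EuclideanSpace ℝ (Fin n) × ℝ → EuclideanSpace ℝ (Fin n) := fun q =>
    chartFlux g T y q.1
      (fderiv ℝ (fun z => u ((extChartAt (𝓡 n) y).symm z) q.2) q.1) with hflux
  have hfluxC : ContDiffOn ℝ ∞ flux (V ×ˢ J) :=
    ((contDiffOn_chartFlux g hT y).comp contDiffOn_fst hfst).clm_apply
      (contDiffOn_space_fderiv hV hJ (contDiffOn_chart_time hu y))
  have hHC : ∀ i, ContDiffOn ℝ ∞ (fun q => volDensity g y q.1 * flux q i) (V ×ˢ J) := fun i =>
    ((contDiffOn_volDensity g y).comp contDiffOn_fst hfst).mul (contDiffOn_euclidean.1 hfluxC i)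
  have hw : ∀ t ∈ J, ContMDiff (𝓡 n) 𝓘(ℝ) ∞ fun x => u x t := fun t ht => contMDiff_slice hu ht
  have hfield : ∀ t ∈ J, ∀ z ∈ V, chartField (fluxField g T fun x => u x t) y z = flux (z, t) :=
    fun t ht z hz => chartField_flux g T hz ((hw t ht).mdifferentiableAt (by simp))
  set D : EuclideanSpace ℝ (Fin n) × ℝ → ℝ := fun q =>
    (volDensity g y q.1)⁻¹ * (∑ i, fderiv ℝ (fun z => volDensity g y z * flux (z, q.2) i) q.1
      (EuclideanSpace.single i 1)) -
      fderiv ℝ (fun z => f ((extChartAt (𝓡 n) y).symm z)) q.1 (flux q) with hD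
  have hDC : ContinuousOn D (V ×ˢ J) := by
    refine ContinuousOn.sub (ContinuousOn.mul ?_ (continuousOn_finsetSum _ fun i _ => ?_)) ?_
    · exact ((contDiffOn_volDensity g y).continuousOn.comp continuousOn_fst hfst).inv₀
        fun q hq => (volDensity_pos g hq.1).ne'
    · exact (contDiffOn_space_fderiv hV hJ (hHC i)).continuousOn.clm_apply continuousOn_const
    · exact (((contDiffOn_comp_symm (by simp) hf y).continuousOn_fderiv_of_isOpen hV
        (by simp)).comp continuousOn_fst hfst).clm_apply hfluxC.continuousOn
  refine (continuousOn_comp_chart hDC).congr fun p hp => ?_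
  have hX := isC1Field_fluxField hT (hw p.2 hp.2)
  have hz : extChartAt (𝓡 n) y p.1 ∈ V := (extChartAt (𝓡 n) y).map_source hp.1
  simp only [diffusion_eq, divergence_eq hX hp.1,
    dirDeriv_eq_fderiv hp.1 (hf.mdifferentiableAt (by simp)), hfield p.2 hp.2 _ hz, hD,
    chartDivergence]
  congr 2
  refine Finset.sum_congr rfl fun i _ => ?_
  have : (fun z => volDensity g y z * chartField (fluxField g T fun x => u x p.2) y z i)
      =ᶠ[nhds (extChartAt (𝓡 n) y p.1)] fun z => volDensity g y z * flux (z, p.2) i := by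
    filter_upwards [hV.mem_nhds hz] with z hz'
    rw [hfield p.2 hp.2 z hz']
  rw [this.fderiv_eq]

theorem contMDiffOn_component {u : M → ℝ → EuclideanSpace ℝ (Fin N)}
    (hu : ContMDiffOn ((𝓡 n).prod 𝓘(ℝ)) 𝓘(ℝ, EuclideanSpace ℝ (Fin N)) ∞
      (fun p : M × ℝ => u p.1 p.2) (univ ×ˢ J)) (k : Fin N) :
    ContMDiffOn ((𝓡 n).prod 𝓘(ℝ)) 𝓘(ℝ) ∞ (fun p : M × ℝ => u p.1 p.2 k) (univ ×ˢ J) :=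
  (EuclideanSpace.proj (𝕜 := ℝ) k).contDiff.contMDiff.comp_contMDiffOn hu

theorem continuousOn_vecDiffusion_time (hJ : UniqueDiffOn ℝ J) (hf : ContMDiff (𝓡 n) 𝓘(ℝ) 1 f)
    (hT : IsSymmPosTensor g T) {u : M → ℝ → EuclideanSpace ℝ (Fin N)}
    (hu : ContMDiffOn ((𝓡 n).prod 𝓘(ℝ)) 𝓘(ℝ, EuclideanSpace ℝ (Fin N)) ∞
      (fun p : M × ℝ => u p.1 p.2) (univ ×ˢ J)) :
    ContinuousOn (fun p : M × ℝ => vecDiffusion g f T (fun y => u y p.2) p.1) (univ ×ˢ J) :=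
  (PiLp.continuous_toLp 2 _).comp_continuousOn (continuousOn_pi.2 fun k =>
    continuousOn_diffusion_time hJ hf hT (u := fun x t => u x t k) (contMDiffOn_component hu k))

end SpaceTime

/-! ### The differential inequality for the frequency -/

section Growth

variable {a b S K : ℝ} {I D I' D' ψ : ℝ → ℝ}

/-- The growth bound on an interval on which `I` is known to be positive. -/
theorem growth_of_pos_on {c : ℝ} (hcb : c ≤ b) (hac : a ≤ c)
    (hI : ∀ t ∈ Icc a b, HasDerivWithinAt I (I' t) (Icc a b) t)
    (hD : ∀ t ∈ Icc a b, HasDerivWithinAt D (D' t) (Icc a b) t)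
    (hD0 : ∀ t ∈ Icc a b, D t ≤ 0) (hψS : ∀ t ∈ Icc a b, ψ t ≤ S)
    (hψ : IntervalIntegrable (fun t => ψ t ^ 2) volume a b) (hK : ∫ t in a..b, ψ t ^ 2 ≤ K)
    (hψ0 : ∀ t ∈ Icc a b, 0 < I t → 0 ≤ ψ t)
    (h1 : ∀ t ∈ Icc a b, 0 < I t → (2 + ψ t) * D t - 3 * ψ t * I t ≤ I' t)
    (h2 : ∀ t ∈ Icc a b, 0 < I t → -(ψ t ^ 2 * I t * (I t - D t)) ≤ D' t * I t - D t * I' t)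
    (hpos : ∀ t ∈ Icc a c, 0 < I t) :
    I a * Real.exp ((c - a) * ((2 + S) * Real.exp K * (D a / I a - 1) + 2 - 2 * S)) ≤ I c := by
  have hsub : Icc a c ⊆ Icc a b := Icc_subset_Icc_right hcb
  have haI : a ∈ Icc a c := ⟨le_rfl, hac⟩
  have hnhds : ∀ t ∈ Ioo a c, Icc a b ∈ nhds t := fun t ht =>
    Icc_mem_nhds ht.1 (ht.2.trans_le hcb)
  have hIc : ContinuousOn I (Icc a c) := fun t ht =>
    (hI t (hsub ht)).continuousWithinAt.mono hsub
  have hDc : ContinuousOn D (Icc a c) := fun t ht =>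
    (hD t (hsub ht)).continuousWithinAt.mono hsub
  have hU : ∀ t ∈ Icc a c, 0 < 1 - D t / I t := fun t ht => by
    have := div_nonpos_of_nonpos_of_nonneg (hD0 t (hsub ht)) (hpos t ht).le
    linarith
  have hfreq : ∀ s ∈ Icc a c, 1 - D s / I s ≤ Real.exp K * (1 - D a / I a) := by
    intro s hs
    have hsc : Icc a s ⊆ Icc a c := Icc_subset_Icc_right hs.2
    -- `(log(1 - U))' = -U'/(1 - U) ≤ ψ²`. This form of the fundamental theorem asks only that the
    -- bound `ψ²` be integrable.
    have hG := intervalIntegral.sub_le_integral_of_hasDeriv_right_of_le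
      (g := fun t => Real.log (1 - D t / I t))
      (g' := fun t => -((D' t * I t - D t * I' t) / I t ^ 2) / (1 - D t / I t))
      (φ := fun t => ψ t ^ 2) hs.1
      (ContinuousOn.log (continuousOn_const.sub ((hDc.mono hsc).div (hIc.mono hsc)
        fun t ht => (hpos t (hsc ht)).ne')) fun t ht => (hU t (hsc ht)).ne')
      (fun t ht => by
        have htc : t ∈ Ioo a c := ⟨ht.1, ht.2.trans_le hs.2⟩
        have htI := hpos t ⟨htc.1.le, htc.2.le⟩
        have htb : t ∈ Icc a b := hsub ⟨htc.1.le, htc.2.le⟩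
        have hd := (((hD t htb).hasDerivAt (hnhds t htc)).div
          ((hI t htb).hasDerivAt (hnhds t htc)) htI.ne').const_sub 1
        exact (hd.log (hU t ⟨htc.1.le, htc.2.le⟩).ne').hasDerivWithinAt)
      ((intervalIntegrable_iff_integrableOn_Icc_of_le (hs.1.trans (hs.2.trans hcb))).1 hψ |>.mono_set
        (Icc_subset_Icc_right (hs.2.trans hcb)))
      (fun t ht => by
        have htc : t ∈ Icc a c := ⟨ht.1.le, ht.2.le.trans hs.2⟩
        have htI := hpos t htc
        rw [div_le_iff₀ (hU t htc), neg_le, le_div_iff₀ (by positivity)]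
        refine le_trans (le_of_eq ?_) (h2 t (hsub htc) htI)
        field_simp)
    have hmono : ∫ t in a..s, ψ t ^ 2 ≤ ∫ t in a..b, ψ t ^ 2 :=
      intervalIntegral.integral_mono_interval le_rfl hs.1 (hs.2.trans hcb)
        (Filter.Eventually.of_forall fun t => sq_nonneg _) hψ
    have hle : Real.log (1 - D s / I s) ≤ K + Real.log (1 - D a / I a) := by linarith
    rw [← Real.exp_log (hU s hs), ← Real.exp_log (hU a haI), ← Real.exp_add]
    exact Real.exp_le_exp.2 hle
  set C := (2 + S) * Real.exp K * (D a / I a - 1) + 2 - 2 * S with hC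
  -- `(log I)' ≥ (2 + ψ)U - 3ψ = 2 - 2ψ - (2 + ψ)(1 - U) ≥ C`.
  have hmono : MonotoneOn (fun t => Real.log (I t) - C * t) (Icc a c) := by
    refine monotoneOn_of_hasDerivWithinAt_nonneg (f' := fun t => I' t / I t - C) (convex_Icc a c)
      ((hIc.log fun t ht => (hpos t ht).ne').sub (continuousOn_const.mul continuousOn_id)) ?_ ?_
    · intro t ht
      rw [interior_Icc] at ht
      have htc : t ∈ Icc a c := Ioo_subset_Icc_self ht
      have hd := ((hI t (hsub htc)).hasDerivAt (hnhds t ht)).log (hpos t htc).ne'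
      have := hd.sub ((hasDerivAt_id t).const_mul C)
      rw [mul_one] at this
      exact this.hasDerivWithinAt
    · intro t ht
      rw [interior_Icc] at ht
      have htc : t ∈ Icc a c := Ioo_subset_Icc_self ht
      have htI := hpos t htc
      have hψt := hψ0 t (hsub htc) htI
      have hI1 : (2 + ψ t) * (D t / I t) - 3 * ψ t ≤ I' t / I t := by
        rw [le_div_iff₀ htI]
        refine le_trans (le_of_eq ?_) (h1 t (hsub htc) htI)
        field_simp
      have hF := hfreq t htc
      have hS := hψS t (hsub htc)
      have hUt := hU t htc
      have hUa := hU a haI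
      -- The sign `0 ≤ ψ t ≤ S` gives `0 ≤ 2 + S`, needed to multiply the two upper bounds.
      have e1 : (2 + ψ t) * (1 - D t / I t) ≤ (2 + S) * (Real.exp K * (1 - D a / I a)) := by
        gcongr
        linarith
      rw [hC]
      linarith
  have hle := hmono haI ⟨hac, le_rfl⟩ hac
  simp only at hle
  have hIa := hpos a haI
  have hIcpos := hpos c ⟨hac, le_rfl⟩
  rw [← Real.exp_log hIa, ← Real.exp_add, ← Real.le_log_iff_exp_le hIcpos]
  linarith

/-- The growth bound: `I` cannot reach zero. -/
theorem growth (hab : a ≤ b)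
    (hI : ∀ t ∈ Icc a b, HasDerivWithinAt I (I' t) (Icc a b) t)
    (hD : ∀ t ∈ Icc a b, HasDerivWithinAt D (D' t) (Icc a b) t)
    (hD0 : ∀ t ∈ Icc a b, D t ≤ 0) (hψS : ∀ t ∈ Icc a b, ψ t ≤ S)
    (hψ : IntervalIntegrable (fun t => ψ t ^ 2) volume a b) (hK : ∫ t in a..b, ψ t ^ 2 ≤ K)
    (hψ0 : ∀ t ∈ Icc a b, 0 < I t → 0 ≤ ψ t)
    (h1 : ∀ t ∈ Icc a b, 0 < I t → (2 + ψ t) * D t - 3 * ψ t * I t ≤ I' t)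
    (h2 : ∀ t ∈ Icc a b, 0 < I t → -(ψ t ^ 2 * I t * (I t - D t)) ≤ D' t * I t - D t * I' t)
    (hIa : 0 < I a) :
    I a * Real.exp ((b - a) * ((2 + S) * Real.exp K * (D a / I a - 1) + 2 - 2 * S)) ≤ I b := by
  have hIc : ContinuousOn I (Icc a b) := fun t ht => (hI t ht).continuousWithinAt
  refine growth_of_pos_on le_rfl hab hI hD hD0 hψS hψ hK hψ0 h1 h2 ?_
  by_contra! hne
  -- Let `c` be the first zero. On `[a, s]` with `s < c` the bound holds with the same constants;
  -- letting `s → c` gives `I c > 0`, a contradiction.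
  set Z := Icc a b ∩ I ⁻¹' Iic 0 with hZ
  have hZne : Z.Nonempty := hne
  have hZc : IsClosed Z := hIc.preimage_isClosed_of_isClosed isClosed_Icc isClosed_Iic
  have hZb : BddBelow Z := ⟨a, fun t ht => ht.1.1⟩
  obtain ⟨hcI, hc0⟩ : sInf Z ∈ Z := hZc.csInf_mem hZne hZb
  set c := sInf Z with hc
  replace hc0 : I c ≤ 0 := hc0
  have hac : a < c := hcI.1.lt_of_ne fun h => by
    rw [← h] at hc0
    exact hc0.not_gt hIa
  have hlow : ∀ s ∈ Ico a c, 0 < I s := fun s hs => by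
    by_contra! h
    exact (csInf_le hZb (show s ∈ Z from ⟨⟨hs.1, hs.2.le.trans hcI.2⟩, h⟩)).not_gt hs.2
  have hbound := ContinuousWithinAt.closure_le (s := Ico a c) (x := c)
    (f := fun s => I a * Real.exp ((s - a) *
      ((2 + S) * Real.exp K * (D a / I a - 1) + 2 - 2 * S))) (g := I)
    (by rw [closure_Ico hac.ne]; exact ⟨hac.le, le_rfl⟩)
    (by fun_prop) ((hIc c hcI).mono fun s hs => ⟨hs.1, hs.2.le.trans hcI.2⟩)
    fun s hs => growth_of_pos_on (hs.2.le.trans hcI.2) hs.1 hI hD hD0 hψS hψ hK hψ0 h1 h2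
      fun r hr => hlow r ⟨hr.1, hr.2.trans_lt hs.2⟩
  exact (hbound.trans hc0).not_gt (mul_pos hIa (Real.exp_pos _))

end Growth

/-! ### Derivatives of the weighted energies -/

section Parametric

variable {M H : Type*} [TopologicalSpace M] [CompactSpace M] [MeasurableSpace M] [BorelSpace M]
  [NormedAddCommGroup H] [InnerProductSpace ℝ H] {a b : ℝ}

theorem continuous_slice {Y : Type*} [TopologicalSpace Y] {J : Set ℝ} {w : M → ℝ → Y}
    (hw : ContinuousOn (fun p : M × ℝ => w p.1 p.2) (univ ×ˢ J)) {t : ℝ} (ht : t ∈ J) :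
    Continuous fun x => w x t := by
  rw [← continuousOn_univ]
  exact hw.comp (f := fun x => (x, t)) (by fun_prop) fun x _ => ⟨mem_univ _, ht⟩

/-- If the increments of `A` are the pairings of those of `u` with the sums of the values of `W`,
then `A` is differentiable. -/
theorem hasDerivWithinAt_of_pairing (μ : Measure M) [IsFiniteMeasure μ] {u u' W : M → ℝ → H}
    {A : ℝ → ℝ}
    (hu : ∀ x, ∀ t ∈ Icc a b, HasDerivWithinAt (u x) (u' x t) (Icc a b) t)
    (huc : ContinuousOn (fun p : M × ℝ => u p.1 p.2) (univ ×ˢ Icc a b))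
    (hu' : ContinuousOn (fun p : M × ℝ => u' p.1 p.2) (univ ×ˢ Icc a b))
    (hW : ContinuousOn (fun p : M × ℝ => W p.1 p.2) (univ ×ˢ Icc a b))
    (hA : ∀ s ∈ Icc a b, ∀ t ∈ Icc a b,
      A s - A t = ∫ x, inner ℝ (u x s - u x t) (W x s + W x t) ∂μ) {t : ℝ} (ht : t ∈ Icc a b) :
    HasDerivWithinAt A (2 * ∫ x, inner ℝ (u' x t) (W x t) ∂μ) (Icc a b) t := by
  have hcpt : IsCompact ((univ : Set M) ×ˢ Icc a b) := isCompact_univ.prod isCompact_Icc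
  obtain ⟨C₁, hC₁⟩ := hcpt.exists_bound_of_continuousOn hu'
  obtain ⟨C₂, hC₂⟩ := hcpt.exists_bound_of_continuousOn hW
  rw [← hasDerivWithinAt_sdiff_singleton,
    hasDerivWithinAt_iff_tendsto_slope' (by simp : t ∉ Icc a b \ {t})]
  have hev : ∀ᶠ s in nhdsWithin t (Icc a b \ {t}), s ∈ Icc a b \ {t} := self_mem_nhdsWithin
  have hslope : ∀ᶠ s in nhdsWithin t (Icc a b \ {t}),
      ∫ x, inner ℝ (slope (u x) t s) (W x s + W x t) ∂μ = slope A t s := by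
    filter_upwards [hev] with s hs
    simp only [slope_def_module, inner_smul_left, RCLike.conj_to_real]
    rw [integral_const_mul, hA s hs.1 t ht, smul_eq_mul]
  have hlim : ∫ x, inner ℝ (u' x t) (W x t + W x t) ∂μ =
      2 * ∫ x, inner ℝ (u' x t) (W x t) ∂μ := by
    rw [← integral_const_mul]
    simp only [inner_add_right, two_mul]
  rw [← hlim]
  refine Filter.Tendsto.congr' hslope ?_
  refine tendsto_integral_filter_of_dominated_convergence (fun _ => C₁ * (C₂ + C₂)) ?_ ?_
    (integrable_const _) (Filter.Eventually.of_forall fun x => ?_)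
  · filter_upwards [hev] with s hs
    have h1 := continuous_slice huc hs.1
    have h2 := continuous_slice huc ht
    have h3 := continuous_slice hW hs.1
    have h4 := continuous_slice hW ht
    refine Continuous.aestronglyMeasurable ?_
    simp only [slope_def_module]
    exact ((h1.sub h2).const_smul _).inner (h3.add h4)
  · filter_upwards [hev] with s hs
    refine Filter.Eventually.of_forall fun x => ?_
    have hne : 0 < ‖s - t‖ := norm_pos_iff.2 (sub_ne_zero.2 hs.2)
    -- The mean value inequality bounds the quotients uniformly in `x`, which supplies the
    -- dominating constant.
    have hlip : ‖slope (u x) t s‖ ≤ C₁ := by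
      have := (convex_Icc a b).norm_image_sub_le_of_norm_hasDerivWithin_le (hu x)
        (fun r hr => hC₁ (x, r) ⟨mem_univ _, hr⟩) ht hs.1
      rw [slope_def_module, norm_smul, norm_inv, inv_mul_le_iff₀ hne, mul_comm]
      exact this
    have hC₁0 : 0 ≤ C₁ := (norm_nonneg _).trans hlip
    calc ‖inner ℝ (slope (u x) t s) (W x s + W x t)‖
        ≤ ‖slope (u x) t s‖ * ‖W x s + W x t‖ := norm_inner_le_norm _ _
      _ ≤ C₁ * (C₂ + C₂) := by
        gcongr
        exact (norm_add_le _ _).trans (add_le_add (hC₂ (x, s) ⟨mem_univ _, hs.1⟩)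
          (hC₂ (x, t) ⟨mem_univ _, ht⟩))
  · have h1 : Filter.Tendsto (slope (u x) t) (nhdsWithin t (Icc a b \ {t})) (nhds (u' x t)) := by
      have := hu x t ht
      rwa [← hasDerivWithinAt_sdiff_singleton,
        hasDerivWithinAt_iff_tendsto_slope' (by simp : t ∉ Icc a b \ {t})] at this
    have h2 : ContinuousWithinAt (W x) (Icc a b) t :=
      (hW.comp (f := fun s => (x, s)) (by fun_prop) fun s hs => ⟨mem_univ _, hs⟩) t ht
    have h3 : Filter.Tendsto (W x) (nhdsWithin t (Icc a b \ {t})) (nhds (W x t)) :=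
      h2.mono_left (nhdsWithin_mono _ sdiff_subset)
    exact h1.inner (h3.add_const _)

end Parametric

/-! ### Integral inequalities at a fixed time. -/

section Energy

variable {M H : Type*} [MeasurableSpace M] [NormedAddCommGroup H] [InnerProductSpace ℝ H]
  {μ : Measure M} {v w h : M → H} {e : M → ℝ} {ψ : ℝ}

/-- Here `v`, `w`, `h`, `e` stand for `u`, `𝓛u`, `u_t - 𝓛u` and `T(∇u, ∇u)` at one time, so `w + h`
is `u_t`. -/
theorem mass_derivative_bound (hψ : 0 ≤ ψ) (he : ∀ x, 0 ≤ e x)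
    (hb : ∀ x, ‖h x‖ ≤ ψ * (‖v x‖ + Real.sqrt (e x)))
    (ivv : Integrable (fun x => ‖v x‖ ^ 2) μ) (ie : Integrable e μ)
    (ivw : Integrable (fun x => inner ℝ (v x) (w x)) μ)
    (ivh : Integrable (fun x => inner ℝ (v x) (h x)) μ)
    (hD : ∫ x, inner ℝ (v x) (w x) ∂μ = -∫ x, e x ∂μ) :
    (2 + ψ) * (-∫ x, e x ∂μ) - 3 * ψ * ∫ x, ‖v x‖ ^ 2 ∂μ ≤
      2 * ∫ x, inner ℝ (w x + h x) (v x) ∂μ := by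
  -- `|v||h| ≤ ψ(|v|² + |v|√e)`, and `|v|√e ≤ (|v|² + e)/2`.
  have hpt : ∀ x, -(ψ / 2) * (3 * ‖v x‖ ^ 2 + e x) ≤ inner ℝ (v x) (h x) := fun x => by
    have h1 := neg_le_of_abs_le ((abs_real_inner_le_norm (v x) (h x)).trans
      (mul_le_mul_of_nonneg_left (hb x) (norm_nonneg _)))
    have h2 := Real.sq_sqrt (he x)
    nlinarith [mul_nonneg hψ (sq_nonneg (‖v x‖ - Real.sqrt (e x)))]
  have hint := integral_mono (((ivv.const_mul 3).add ie).const_mul (-(ψ / 2))) ivh hpt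
  simp only [Pi.add_apply] at hint
  rw [integral_const_mul, integral_add (ivv.const_mul 3) ie, integral_const_mul] at hint
  have hsum : ∫ x, inner ℝ (w x + h x) (v x) ∂μ =
      ∫ x, inner ℝ (v x) (w x) ∂μ + ∫ x, inner ℝ (v x) (h x) ∂μ := by
    rw [← integral_add ivw ivh]
    simp only [real_inner_comm, inner_add_right]
  rw [hsum, hD]
  linarith

/-- Cauchy-Schwarz is applied to `v` and `w + h/2`: completing the square this way leaves only
`-(I/2)∫|h|²` as error. -/
theorem frequency_derivative_bound (he : ∀ x, 0 ≤ e x)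
    (hb : ∀ x, ‖h x‖ ≤ ψ * (‖v x‖ + Real.sqrt (e x)))
    (ivv : Integrable (fun x => ‖v x‖ ^ 2) μ) (iww : Integrable (fun x => ‖w x‖ ^ 2) μ)
    (ihh : Integrable (fun x => ‖h x‖ ^ 2) μ) (ie : Integrable e μ)
    (ivw : Integrable (fun x => inner ℝ (v x) (w x)) μ)
    (ivh : Integrable (fun x => inner ℝ (v x) (h x)) μ)
    (iwh : Integrable (fun x => inner ℝ (w x) (h x)) μ)
    (hD : ∫ x, inner ℝ (v x) (w x) ∂μ = -∫ x, e x ∂μ) (hpos : 0 < ∫ x, ‖v x‖ ^ 2 ∂μ) :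
    -(ψ ^ 2 * (∫ x, ‖v x‖ ^ 2 ∂μ) * (∫ x, ‖v x‖ ^ 2 ∂μ - -∫ x, e x ∂μ)) ≤
      2 * (∫ x, inner ℝ (w x + h x) (w x) ∂μ) * ∫ x, ‖v x‖ ^ 2 ∂μ -
        (-∫ x, e x ∂μ) * (2 * ∫ x, inner ℝ (w x + h x) (v x) ∂μ) := by
  have hH : ∫ x, ‖h x‖ ^ 2 ∂μ ≤ 2 * ψ ^ 2 * (∫ x, ‖v x‖ ^ 2 ∂μ + ∫ x, e x ∂μ) := by
    rw [← integral_add ivv ie, ← integral_const_mul]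
    refine integral_mono ihh ((ivv.add ie).const_mul _) fun x => ?_
    have h1 := pow_le_pow_left₀ (norm_nonneg _) (hb x) 2
    have h2 := Real.sq_sqrt (he x)
    simp only
    nlinarith [mul_nonneg (sq_nonneg ψ) (sq_nonneg (‖v x‖ - Real.sqrt (e x)))]
  have hwv : ∫ x, inner ℝ (w x + h x) (v x) ∂μ =
      ∫ x, inner ℝ (v x) (w x) ∂μ + ∫ x, inner ℝ (v x) (h x) ∂μ := by
    rw [← integral_add ivw ivh]
    simp only [real_inner_comm, inner_add_right]
  have hww : ∫ x, inner ℝ (w x + h x) (w x) ∂μ =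
      ∫ x, ‖w x‖ ^ 2 ∂μ + ∫ x, inner ℝ (w x) (h x) ∂μ := by
    rw [← integral_add iww iwh]
    refine integral_congr_ae (Filter.Eventually.of_forall fun x => ?_)
    simp only [inner_add_left, real_inner_self_eq_norm_sq, real_inner_comm]
  -- This is `0 ≤ ∫|w + h/2 - r v|²`, expanded; below, `r = (A + B/2)/I` minimizes it.
  have hCS : ∀ r : ℝ, 0 ≤ ∫ x, ‖w x‖ ^ 2 ∂μ + (1 / 4) * ∫ x, ‖h x‖ ^ 2 ∂μ
      + ∫ x, inner ℝ (w x) (h x) ∂μ - 2 * r * (∫ x, inner ℝ (v x) (w x) ∂μ)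
      - r * (∫ x, inner ℝ (v x) (h x) ∂μ) + r ^ 2 * ∫ x, ‖v x‖ ^ 2 ∂μ := fun r => by
    have j1 : Integrable (fun x => ‖w x‖ ^ 2 + 1 / 4 * ‖h x‖ ^ 2) μ := iww.add (ihh.const_mul _)
    have j2 : Integrable (fun x => ‖w x‖ ^ 2 + 1 / 4 * ‖h x‖ ^ 2 + inner ℝ (w x) (h x)) μ :=
      j1.add iwh
    have j3 : Integrable (fun x => ‖w x‖ ^ 2 + 1 / 4 * ‖h x‖ ^ 2 + inner ℝ (w x) (h x)
        - 2 * r * inner ℝ (v x) (w x)) μ := j2.sub (ivw.const_mul _)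
    have j4 : Integrable (fun x => ‖w x‖ ^ 2 + 1 / 4 * ‖h x‖ ^ 2 + inner ℝ (w x) (h x)
        - 2 * r * inner ℝ (v x) (w x) - r * inner ℝ (v x) (h x)) μ := j3.sub (ivh.const_mul _)
    rw [← integral_const_mul (1 / 4), ← integral_const_mul (2 * r), ← integral_const_mul r,
      ← integral_const_mul (r ^ 2), ← integral_add iww (ihh.const_mul _), ← integral_add j1 iwh,
      ← integral_sub j2 (ivw.const_mul _), ← integral_sub j3 (ivh.const_mul _),
      ← integral_add j4 (ivv.const_mul _)]
    refine integral_nonneg fun x => ?_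
    have hsq : ‖w x + (1 / 2 : ℝ) • h x - r • v x‖ ^ 2 = ‖w x‖ ^ 2 + 1 / 4 * ‖h x‖ ^ 2
        + inner ℝ (w x) (h x) - 2 * r * inner ℝ (v x) (w x) - r * inner ℝ (v x) (h x)
        + r ^ 2 * ‖v x‖ ^ 2 := by
      rw [norm_sub_sq_real, norm_add_sq_real]
      simp only [norm_smul, inner_smul_right, mul_pow, Real.norm_eq_abs, sq_abs,
        real_inner_comm (v x), inner_add_right]
      ring
    simp only [Pi.zero_apply]
    rw [← hsq]
    positivity
  rw [hwv, hww]
  set I := ∫ x, ‖v x‖ ^ 2 ∂μ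
  set P := ∫ x, ‖w x‖ ^ 2 ∂μ
  set Q := ∫ x, ‖h x‖ ^ 2 ∂μ
  set R := ∫ x, inner ℝ (w x) (h x) ∂μ
  set A := ∫ x, inner ℝ (v x) (w x) ∂μ
  set B := ∫ x, inner ℝ (v x) (h x) ∂μ
  have hCS' : (A + B / 2) ^ 2 ≤ I * (P + 1 / 4 * Q + R) := by
    have := mul_nonneg hpos.le (hCS ((A + B / 2) / I))
    have e1 : I * (P + 1 / 4 * Q + R - 2 * ((A + B / 2) / I) * A - (A + B / 2) / I * B +
        ((A + B / 2) / I) ^ 2 * I) = I * (P + 1 / 4 * Q + R) - (A + B / 2) ^ 2 := by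
      field_simp
      ring
    linarith
  have hHI := mul_le_mul_of_nonneg_left hH hpos.le
  rw [← hD]
  have : ∫ x, e x ∂μ = -A := by rw [hD, neg_neg]
  rw [this] at hHI
  -- With `A = D`, the right side equals `2(I(P + Q/4 + R) - (A + B/2)²) + B²/2 - IQ/2`. The first
  -- two terms are nonnegative and `hHI` bounds the last.
  nlinarith [sq_nonneg B]

end Energy

/-! ### Derivatives of `I` and `D` for the flow, and growth of `I`. -/

section Frequency

variable {n N : ℕ} {M : Type*} [TopologicalSpace M] [ChartedSpace (EuclideanSpace ℝ (Fin n)) M]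
  [IsManifold (𝓡 n) ∞ M] [CompactSpace M] [T2Space M] [MeasurableSpace M] [BorelSpace M]
  {g : SmoothMetric n M} {f : M → ℝ}
  {T : (x : M) → TangentSpace (𝓡 n) x →L[ℝ] TangentSpace (𝓡 n) x} {a b : ℝ}
  {u : M → ℝ → EuclideanSpace ℝ (Fin N)}

/-- The pairing lemma with `W = u`, since `|p|² - |q|² = ⟨p - q, p + q⟩`. -/
theorem hasDerivWithinAt_freqI (hab : a < b) (hf : Continuous f)
    (hu : ContMDiffOn ((𝓡 n).prod 𝓘(ℝ)) 𝓘(ℝ, EuclideanSpace ℝ (Fin N)) ∞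
      (fun p : M × ℝ => u p.1 p.2) (univ ×ˢ Icc a b)) {t : ℝ} (ht : t ∈ Icc a b) :
    HasDerivWithinAt (freqI g f u)
      (2 * ∫ x, inner ℝ (derivWithin (u x) (Icc a b) t) (u x t) ∂(weightedVolume g f))
      (Icc a b) t := by
  have := isLocallyFiniteMeasure_weightedVolume g hf
  have hi : ∀ s ∈ Icc a b, Integrable (fun x => ‖u x s‖ ^ 2) (weightedVolume g f) := fun s hs =>
    integrable_weightedVolume g hf ((continuous_slice hu.continuousOn hs).norm.pow 2)
  refine hasDerivWithinAt_of_pairing (weightedVolume g f)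
    (u' := fun x s => derivWithin (u x) (Icc a b) s)
    (fun x s hs => hasDerivWithinAt_time hu x hs) hu.continuousOn
    (continuousOn_derivWithin_time (uniqueDiffOn_Icc hab) hu) hu.continuousOn
    (fun s hs r hr => ?_) ht
  rw [freqI, freqI, ← integral_sub (hi s hs) (hi r hr)]
  refine integral_congr_ae (Filter.Eventually.of_forall fun x => ?_)
  simp only [inner_sub_left, inner_add_right, real_inner_self_eq_norm_sq,
    real_inner_comm (u x s) (u x r)]
  ring

/-- The pairing lemma with `W = 𝓛u`: in `∫⟨u_s - u_r, 𝓛u_s + 𝓛u_r⟩`, where the subscripts are times,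
the cross terms cancel by symmetry of `𝓛`. -/
theorem hasDerivWithinAt_freqD (hab : a < b) (hf : ContMDiff (𝓡 n) 𝓘(ℝ) 1 f)
    (hT : IsSymmPosTensor g T)
    (hu : ContMDiffOn ((𝓡 n).prod 𝓘(ℝ)) 𝓘(ℝ, EuclideanSpace ℝ (Fin N)) ∞
      (fun p : M × ℝ => u p.1 p.2) (univ ×ˢ Icc a b)) {t : ℝ} (ht : t ∈ Icc a b) :
    HasDerivWithinAt (freqD g f T u)
      (2 * ∫ x, inner ℝ (derivWithin (u x) (Icc a b) t) (vecDiffusion g f T (fun y => u y t) x)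
        ∂(weightedVolume g f)) (Icc a b) t := by
  have := isLocallyFiniteMeasure_weightedVolume g hf.continuous
  have hJ := uniqueDiffOn_Icc hab
  have hW := continuousOn_vecDiffusion_time (g := g) hJ hf hT hu
  have hi : ∀ s ∈ Icc a b, ∀ r ∈ Icc a b,
      Integrable (fun x => inner ℝ (u x s) (vecDiffusion g f T (fun y => u y r) x))
        (weightedVolume g f) := fun s hs r hr => integrable_weightedVolume g hf.continuous
    ((continuous_slice hu.continuousOn hs).inner
      (continuous_slice (w := fun x r => vecDiffusion g f T (fun y => u y r) x) hW hr))
  refine hasDerivWithinAt_of_pairing (weightedVolume g f)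
    (u' := fun x s => derivWithin (u x) (Icc a b) s)
    (W := fun x s => vecDiffusion g f T (fun y => u y s) x)
    (fun x s hs => hasDerivWithinAt_time hu x hs) hu.continuousOn
    (continuousOn_derivWithin_time hJ hu) hW (fun s hs r hr => ?_) ht
  have hsm := contMDiff_slice hu hs
  have hrm := contMDiff_slice hu hr
  rw [freqD, freqD, ← integral_inner_vecDiffusion_self hf hT hsm,
    ← integral_inner_vecDiffusion_self hf hT hrm]
  simp only [inner_sub_left, inner_add_right]
  have i1 := (hi s hs s hs).sub (hi r hr s hs)
  have i2 := (hi s hs r hr).sub (hi r hr r hr)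
  simp only [Pi.sub_def] at i1 i2
  rw [integral_add i1 i2, integral_sub (hi s hs s hs) (hi r hr s hs),
    integral_sub (hi s hs r hr) (hi r hr r hr),
    integral_inner_vecDiffusion_comm hf hT hsm hrm]
  ring

theorem eq_zero_of_freqI_eq_zero (hf : Continuous f) {t : ℝ} (hu : Continuous fun x => u x t)
    (h : freqI g f u t = 0) (x : M) : u x t = 0 := by
  have := isOpenPosMeasure_weightedVolume g hf
  have hc : Continuous fun x => ‖u x t‖ ^ 2 := hu.norm.pow 2
  rw [freqI, integral_eq_zero_iff_of_nonneg (fun x => by positivity)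
    (integrable_weightedVolume g hf hc)] at h
  have h0 := (Continuous.ae_eq_iff_eq _ hc continuous_const).1 h
  exact norm_eq_zero.1 (pow_eq_zero_iff two_ne_zero |>.1 (congrFun h0 x))

/-- The lower bound for `I` on a subinterval `[c, b]` of `[a, b]`. -/
theorem freqI_growth (hab : a < b) (hf : ContMDiff (𝓡 n) 𝓘(ℝ) 1 f) (hT : IsSymmPosTensor g T)
    {ψ : ℝ → ℝ} (hψ_bdd : BddAbove (ψ '' Icc a b))
    (hψ_int : IntervalIntegrable (fun t => ψ t ^ 2) volume a b)
    (hu : ContMDiffOn ((𝓡 n).prod 𝓘(ℝ)) 𝓘(ℝ, EuclideanSpace ℝ (Fin N)) ∞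
      (fun p : M × ℝ => u p.1 p.2) (univ ×ˢ Icc a b))
    (hineq : ∀ x : M, ∀ t ∈ Icc a b,
      ‖derivWithin (fun s => u x s) (Icc a b) t - vecDiffusion g f T (fun y => u y t) x‖
        ≤ ψ t * (‖u x t‖ + Real.sqrt (gradEnergy g T (fun y => u y t) x)))
    {c : ℝ} (hc : c ∈ Icc a b) (hpos : 0 < freqI g f u c) :
    freqI g f u c * Real.exp ((b - c) * ((2 + sSup (ψ '' Icc a b)) *
      Real.exp (∫ t in a..b, ψ t ^ 2) * (freqD g f T u c / freqI g f u c - 1)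
        + 2 - 2 * sSup (ψ '' Icc a b))) ≤ freqI g f u b := by
  have hJ := uniqueDiffOn_Icc hab
  have hsub : Icc c b ⊆ Icc a b := Icc_subset_Icc_left hc.1
  have hintc : IntervalIntegrable (fun t => ψ t ^ 2) volume c b :=
    hψ_int.mono_set (by rw [uIcc_of_le hc.2, uIcc_of_le hab.le]; exact hsub)
  -- No sign of `ψ` is assumed; a negative value makes the right side of the differential inequality
  -- nonpositive and forces `u(·, t) = 0`.
  have hψ0 : ∀ t ∈ Icc a b, 0 < freqI g f u t → 0 ≤ ψ t := fun t ht hIt => by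
    by_contra! hneg
    refine hIt.ne' ?_
    have hz : ∀ x, u x t = 0 := fun x => by
      have h1 := (norm_nonneg _).trans (hineq x t ht)
      have h2 := nonpos_of_mul_nonneg_right h1 hneg
      have h3 := Real.sqrt_nonneg (gradEnergy g T (fun y => u y t) x)
      exact norm_le_zero_iff.1 (by linarith)
    simp [freqI, hz]
  have henergy : ∀ t ∈ Icc a b,
      Integrable (gradEnergy g T fun y => u y t) (weightedVolume g f) := fun t ht =>
    integrable_weightedVolume g hf.continuous (continuous_gradEnergy hT (contMDiff_slice hu ht))
  have huc : ∀ t ∈ Icc a b, Continuous fun x => u x t := fun t ht =>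
    continuous_slice hu.continuousOn ht
  have hLc : ∀ t ∈ Icc a b, Continuous (vecDiffusion g f T fun y => u y t) := fun t ht =>
    continuous_vecDiffusion hf hT (contMDiff_slice hu ht)
  have hhc : ∀ t ∈ Icc a b, Continuous fun x =>
      derivWithin (u x) (Icc a b) t - vecDiffusion g f T (fun y => u y t) x := fun t ht =>
    (continuous_slice (w := fun x t => derivWithin (u x) (Icc a b) t)
      (continuousOn_derivWithin_time hJ hu) ht).sub (hLc t ht)
  have hint : ∀ {q : M → ℝ}, Continuous q → Integrable q (weightedVolume g f) :=
    fun hq => integrable_weightedVolume g hf.continuous hq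
  have hD : ∀ t ∈ Icc a b, ∫ x, inner ℝ (u x t) (vecDiffusion g f T (fun y => u y t) x)
      ∂(weightedVolume g f) = -∫ x, gradEnergy g T (fun y => u y t) x ∂(weightedVolume g f) :=
    fun t ht => integral_inner_vecDiffusion_self hf hT (contMDiff_slice hu ht)
  -- The supremum and integral over all of `[a, b]` remain valid upper bounds on `[c, b]`.
  refine growth (S := sSup (ψ '' Icc a b)) (K := ∫ t in a..b, ψ t ^ 2) (ψ := ψ) hc.2
    (fun t ht => (hasDerivWithinAt_freqI hab hf.continuous hu (hsub ht)).mono hsub)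
    (fun t ht => (hasDerivWithinAt_freqD hab hf hT hu (hsub ht)).mono hsub)
    (fun t _ => neg_nonpos.2 (integral_nonneg fun x => gradEnergy_nonneg hT _ x))
    (fun t ht => le_csSup hψ_bdd (mem_image_of_mem ψ (hsub ht))) hintc
    (intervalIntegral.integral_mono_interval hc.1 hc.2 le_rfl
      (Filter.Eventually.of_forall fun t => sq_nonneg _) hψ_int)
    (fun t ht => hψ0 t (hsub ht)) (fun t ht hIt => ?_) (fun t ht hIt => ?_) hpos
  · have ht' := hsub ht
    have h := mass_derivative_bound (hψ0 t ht' hIt) (gradEnergy_nonneg hT fun y => u y t)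
      (fun x => hineq x t ht') (hint ((huc t ht').norm.pow 2)) (henergy t ht')
      (hint ((huc t ht').inner (hLc t ht'))) (hint ((huc t ht').inner (hhc t ht'))) (hD t ht')
    simp only [add_sub_cancel] at h
    exact h
  · have ht' := hsub ht
    have h := frequency_derivative_bound (gradEnergy_nonneg hT fun y => u y t)
      (fun x => hineq x t ht') (hint ((huc t ht').norm.pow 2)) (hint ((hLc t ht').norm.pow 2))
      (hint ((hhc t ht').norm.pow 2)) (henergy t ht')
      (hint ((huc t ht').inner (hLc t ht'))) (hint ((huc t ht').inner (hhc t ht')))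
      (hint ((hLc t ht').inner (hhc t ht'))) (hD t ht') hIt
    simp only [add_sub_cancel] at h
    exact h

end Frequency

end

end ParabolicFrequency

/-! ### The growth estimate and backward uniqueness. -/

theorem corollary4 {n N : ℕ} {M : Type*} [TopologicalSpace M]
    [ChartedSpace (EuclideanSpace ℝ (Fin n)) M] [IsManifold (𝓡 n) ∞ M]
    [CompactSpace M] [T2Space M] [MeasurableSpace M] [BorelSpace M]
    (g : ParabolicFrequency.SmoothMetric n M)
    (f : M → ℝ) (hf : ContMDiff (𝓡 n) 𝓘(ℝ) 2 f)
    (T : (x : M) → TangentSpace (𝓡 n) x →L[ℝ] TangentSpace (𝓡 n) x)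
    (hT : ParabolicFrequency.IsSymmPosTensor g T)
    (a b : ℝ) (hab : a < b)
    (ψ : ℝ → ℝ) (hψ_bdd : BddAbove (ψ '' Icc a b))
    (hψ_int : IntervalIntegrable (fun t => ψ t ^ 2) volume a b)
    (u : M → ℝ → EuclideanSpace ℝ (Fin N))
    (hu : ContMDiffOn ((𝓡 n).prod 𝓘(ℝ)) 𝓘(ℝ, EuclideanSpace ℝ (Fin N)) ∞
      (fun p : M × ℝ => u p.1 p.2) (univ ×ˢ Icc a b))
    (hineq : ∀ x : M, ∀ t ∈ Icc a b,
      ‖derivWithin (fun s => u x s) (Icc a b) t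
          - ParabolicFrequency.vecDiffusion g f T (fun y => u y t) x‖
        ≤ ψ t * (‖u x t‖
          + Real.sqrt (ParabolicFrequency.gradEnergy g T (fun y => u y t) x))) :
    ParabolicFrequency.freqI g f u b ≥
        ParabolicFrequency.freqI g f u a *
          Real.exp ((b - a) *
            ((2 + sSup (ψ '' Icc a b)) * Real.exp (∫ t in a..b, ψ t ^ 2)
                * (ParabolicFrequency.freqU g f T u a - 1)
              + 2 - 2 * sSup (ψ '' Icc a b))) ∧
      ((∀ x : M, u x b = 0) → ∀ x : M, ∀ t ∈ Icc a b, u x t = 0) := by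
  have hf1 : ContMDiff (𝓡 n) 𝓘(ℝ) 1 f := hf.of_le (by norm_num)
  have hI0 : ∀ t, 0 ≤ ParabolicFrequency.freqI g f u t := fun t =>
    integral_nonneg fun x => by positivity
  have hgrowth := fun (c : ℝ) (hc : c ∈ Icc a b) => ParabolicFrequency.freqI_growth (g := g) hab
    hf1 hT hψ_bdd hψ_int hu hineq hc
  refine ⟨?_, fun hb x t ht => ?_⟩
  · rcases (hI0 a).eq_or_lt with h0 | hpos
    · rw [← h0, zero_mul]
      exact hI0 b
    · exact hgrowth a (left_mem_Icc.2 hab.le) hpos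
  · refine ParabolicFrequency.eq_zero_of_freqI_eq_zero (g := g) hf1.continuous
      (ParabolicFrequency.continuous_slice hu.continuousOn ht) ?_ x
    -- If `I(t) > 0`, the growth bound started at `t` gives `I(b) > 0`, against `u(·, b) = 0`.
    refine ((hI0 t).eq_or_lt.resolve_right fun hpos => ?_).symm
    have hIb : ParabolicFrequency.freqI g f u b = 0 := by simp [ParabolicFrequency.freqI, hb]
    have := hgrowth t ht hpos
    rw [hIb] at this
    exact this.not_gt (mul_pos hpos (Real.exp_pos _))
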